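/- Let $d,N\geq 1$ be integers and let $A,B\in\mathbb C^{N\times N}$ and $S\in\mathbb R^{d\times d}$ be matrices such that - $A$ and $B$ are simultaneously diagonalizable: there is an invertible $Y\in\mathbb C^{N\times N}$ (fixed in the following) such that $Y^{-1}AY$ and $Y^{-1}BY$ are diagonal, - every eigenvalue of $A$ has positive real part, - $S$ is skew-symmetric, $S^{T}=-S$. Let $|\cdot|$ denote the Euclidean norm of vectors and the spectral norm of matrices. For a square matrix $C$ with spectrum $\sigma(C)$ put $\rho(C)=\max_{\mu\in\sigma(C)}|\mu|$ and $s(C)=\max_{\mu\in\sigma(C)}\operatorname{Re}\mu$, and define $$a_{\min}=\rho(A^{-1})^{-1},\quad a_{\max}=\rho(A),\quad a_0=-s(-A),\quad b_0=-s(-B),\quad a_1=\frac{a_{\max}^2}{a_{\min}a_0},\quad \kappa=|Y|\,|Y^{-1}|,$$ $$M_{\mathrm b}=\kappa\,a_1^{d/2},\qquad \omega_{\mathrm b}=-b_0 .$$ For $x,\xi\in\mathbb R^d$ and $t>0$ let $$H(x,\xi,t)=(4\pi tA)^{-d/2}\exp\!\Big(-Bt-(4tA)^{-1}\,|e^{tS}x-\xi|^2\Big)\in\mathbb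 C^{N\times N},$$ where the power is the principal one, and let $[T(t)v](x)=\int_{\mathbb R^d}H(x,\xi,t)v(\xi)\,d\xi$ for $t>0$ and $T(0)v=v$. Let $C_{\mathrm b}(\mathbb R^d,\mathbb C^N)$ be the space of bounded continuous functions with $\|v\|_{C_{\mathrm b}}=\sup_{x}|v(x)|$, and let $C_{\mathrm{rub}}(\mathbb R^d,\mathbb C^N)$ be its closed subspace of all uniformly continuous $v$ with $\lim_{t\to0}\sup_{x\in\mathbb R^d}|v(e^{-tS}x)-v(x)|=0$. The operators $T(t)$, $t\geq0$, map $C_{\mathrm{rub}}$ into itself. Let $A_{\mathrm b}$ be the infinitesimal generator of $(T(t))_{t\ge 0}$ on $C_{\mathrm{rub}}(\mathbb R^d,\mathbb C^N)$: its domain $\mathcal D(A_{\mathrm b})$ consists of all $v\in C_{\mathrm{rub}}$ for which $A_{\mathrm b}v:=\lim_{t\downarrow0}\frac1t(T(t)v-v)$ exists in $C_{\mathrm{rub}}$. Then for every $\lambda\in\mathbb C$ with $\operatorname{Re}\lambda>\omega_{\mathrm b}$ and every $g\in C_{\mathrm{rub}}(\mathbb R^d,\mathbb C^N)$ the resolvent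 equation $$(\lambda I-A_{\mathrm b})v=g$$ has a unique solution $v_\star\in\mathcal D(A_{\mathrm b})$. It is given by $$v_\star=\int_0^\infty e^{-\lambda t}\,T(t)g\,dt=\int_0^\infty e^{-\lambda t}\int_{\mathbb R^d}H(\cdot,\xi,t)\,g(\xi)\,d\xi\,dt,$$ where the first integral converges absolutely in $C_{\mathrm{rub}}(\mathbb R^d,\mathbb C^N)$ and the second one is understood pointwise (all integrals being absolutely convergent), and it satisfies $$\|v_\star\|_{C_{\mathrm b}}\leq\frac{M_{\mathrm b}}{\operatorname{Re}\lambda-\omega_{\mathrm b}}\,\|g\|_{C_{\mathrm b}} .$$ -/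

import Mathlib

open MeasureTheory Filter Topology Set
open scoped BoundedContinuousFunction

namespace OrnsteinUhlenbeck

/-- `ℝ^d` with the Euclidean norm. -/
abbrev RSpace (d : ℕ) : Type := EuclideanSpace ℝ (Fin d)

/-- `ℂ^N` with the Euclidean norm. -/
abbrev CSpace (N : ℕ) : Type := EuclideanSpace ℂ (Fin N)

/-- `N × N` complex matrices. -/
abbrev CMat (N : ℕ) : Type := Matrix (Fin N) (Fin N) ℂ

/-- `d × d` real matrices. -/
abbrev RMat (d : ℕ) : Type := Matrix (Fin d) (Fin d) ℝ

section Assumptions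

/-- The standing assumptions: `Y` is invertible and diagonalizes both `A` and `B`,
all eigenvalues of `A` have positive real part, and `S` is skew-symmetric. -/
structure Assumptions {d N : ℕ} (A B Y : CMat N) (S : RMat d) : Prop where
  isUnit_Y : IsUnit Y
  diag_A : (Y⁻¹ * A * Y).IsDiag
  diag_B : (Y⁻¹ * B * Y).IsDiag
  spec_A : ∀ μ ∈ spectrum ℂ A, 0 < μ.re
  skew_S : S.transpose = -S

end Assumptions

section Constants

/-- The spectral radius `ρ(C) = max {|μ| : μ ∈ σ(C)}`. -/
noncomputable def specRadius {N : ℕ} (C : CMat N) : ℝ :=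
  sSup ((fun μ : ℂ => ‖μ‖) '' spectrum ℂ C)

/-- The spectral abscissa `s(C) = max {Re μ : μ ∈ σ(C)}`. -/
noncomputable def specAbscissa {N : ℕ} (C : CMat N) : ℝ :=
  sSup (Complex.re '' spectrum ℂ C)

/-- The spectral norm (the operator norm for the Euclidean norm) of a matrix. -/
noncomputable def specNorm {N : ℕ} (C : CMat N) : ℝ :=
  ‖Matrix.toEuclideanCLM (n := Fin N) (𝕜 := ℂ) C‖

/-- The condition number `|C| |C⁻¹|`. -/
noncomputable def condNumber {N : ℕ} (C : CMat N) : ℝ := specNorm C * specNorm C⁻¹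

/-- `a_min = ρ(A⁻¹)⁻¹`. -/
noncomputable def aMin {N : ℕ} (A : CMat N) : ℝ := (specRadius A⁻¹)⁻¹

/-- `a_max = ρ(A)`. -/
noncomputable def aMax {N : ℕ} (A : CMat N) : ℝ := specRadius A

/-- `a_0 = -s(-A)`. -/
noncomputable def aZero {N : ℕ} (A : CMat N) : ℝ := -specAbscissa (-A)

/-- `b_0 = -s(-B)`. -/
noncomputable def bZero {N : ℕ} (B : CMat N) : ℝ := -specAbscissa (-B)

/-- `a_1 = a_max² / (a_min a_0)`. -/
noncomputable def aOne {N : ℕ} (A : CMat N) : ℝ := aMax A ^ 2 / (aMin A * aZero A)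

/-- `M_b = κ a_1^{d/2}` with `κ = |Y| |Y⁻¹|`. -/
noncomputable def Mb {N : ℕ} (d : ℕ) (A Y : CMat N) : ℝ :=
  condNumber Y * aOne A ^ ((d : ℝ) / 2)

/-- `ω_b = -b_0`. -/
noncomputable def omegaB {N : ℕ} (B : CMat N) : ℝ := -bZero B

end Constants

section Kernel

/-- The principal power `C^s` of a diagonalizable matrix `C`: the value at `C` of the polynomial
that interpolates the principal branch `z ↦ z^s` at the eigenvalues of `C`. -/
noncomputable def matrixCpow {N : ℕ} (C : CMat N) (s : ℂ) : CMat N :=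
  Polynomial.aeval C (Lagrange.interpolate C.charpoly.roots.toFinset id (fun z : ℂ => z ^ s))

theorem aeval_conj_diagonal {N : ℕ} (Y : CMat N) (hY : IsUnit Y) (a : Fin N → ℂ)
    (p : Polynomial ℂ) :
    Polynomial.aeval (Y * Matrix.diagonal a * Y⁻¹) p
      = Y * Matrix.diagonal (fun i => p.eval (a i)) * Y⁻¹ := by
  have hdet : IsUnit Y.det := (Matrix.isUnit_iff_isUnit_det Y).1 hY
  have hYY : Y⁻¹ * Y = 1 := Matrix.nonsing_inv_mul Y hdet
  have hYY' : Y * Y⁻¹ = 1 := Matrix.mul_nonsing_inv Y hdet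
  have hmul : ∀ u v : Fin N → ℂ, (Y * Matrix.diagonal u * Y⁻¹) * (Y * Matrix.diagonal v * Y⁻¹)
      = Y * Matrix.diagonal (fun i => u i * v i) * Y⁻¹ := by
    intro u v
    calc _ = Y * Matrix.diagonal u * (Y⁻¹ * Y) * Matrix.diagonal v * Y⁻¹ := by
            simp only [mul_assoc]
      _ = Y * (Matrix.diagonal u * Matrix.diagonal v) * Y⁻¹ := by
            rw [hYY]; simp only [mul_assoc, one_mul]
      _ = _ := by rw [Matrix.diagonal_mul_diagonal]
  have hconst : ∀ c : ℂ, Y * Matrix.diagonal (fun _ : Fin N => c) * Y⁻¹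
      = algebraMap ℂ (CMat N) c := by
    intro c
    have : (Matrix.diagonal (fun _ : Fin N => c)) = c • (1 : CMat N) := by
      rw [Matrix.smul_one_eq_diagonal]
    rw [this, mul_smul_comm, smul_mul_assoc, mul_one, hYY', Algebra.algebraMap_eq_smul_one]
  induction p using Polynomial.induction_on with
  | C c => simp [hconst]
  | add p q hp hq =>
    rw [map_add, hp, hq, ← add_mul, ← mul_add, Matrix.diagonal_add]
    simp
  | monomial n c h =>
    rw [pow_succ, ← mul_assoc, map_mul, h, Polynomial.aeval_X, hmul]
    simp

/-- On diagonalizable matrices `matrixCpow` is the principal power taken on the eigenvalues. -/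
theorem matrixCpow_conj_diagonal {N : ℕ} (Y : CMat N) (hY : IsUnit Y) (a : Fin N → ℂ) (s : ℂ) :
    matrixCpow (Y * Matrix.diagonal a * Y⁻¹) s
      = Y * Matrix.diagonal (fun i => a i ^ s) * Y⁻¹ := by
  have hch : (Y * Matrix.diagonal a * Y⁻¹).charpoly = (Matrix.diagonal a).charpoly := by
    obtain ⟨U, rfl⟩ := hY
    exact Matrix.charpoly_units_conj U _
  rw [matrixCpow, aeval_conj_diagonal Y hY, hch]
  congr 3
  funext i
  have hi : a i ∈ (Matrix.diagonal a).charpoly.roots.toFinset := by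
    rw [Matrix.charpoly_diagonal, Multiset.mem_toFinset, Polynomial.mem_roots']
    refine ⟨Finset.prod_ne_zero_iff.2 fun j _ => Polynomial.X_sub_C_ne_zero _, ?_⟩
    rw [Polynomial.IsRoot, Polynomial.eval_prod]
    exact Finset.prod_eq_zero (Finset.mem_univ i) (by simp)
  exact Lagrange.eval_interpolate_at_node _ (Function.injective_id.injOn) hi

/-- The rotation `x ↦ e^{tS} x` of `ℝ^d`. -/
noncomputable def rot {d : ℕ} (S : RMat d) (t : ℝ) : RSpace d →L[ℝ] RSpace d :=
  Matrix.toEuclideanCLM (n := Fin d) (𝕜 := ℝ) (NormedSpace.exp (t • S))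

/-- The kernel `K(ψ, t) = (4πtA)^{-d/2} exp(-Bt - (4tA)⁻¹ |ψ|²)`. -/
noncomputable def kernelK {d N : ℕ} (A B : CMat N) (ψ : RSpace d) (t : ℝ) : CMat N :=
  matrixCpow ((4 * Real.pi * t : ℂ) • A) (-(d : ℂ) / 2) *
    NormedSpace.exp (-((t : ℂ) • B) - ((‖ψ‖ ^ 2 : ℝ) : ℂ) • ((4 * t : ℂ) • A)⁻¹)

/-- The heat kernel matrix
`H(x, ξ, t) = (4πtA)^{-d/2} exp(-Bt - (4tA)⁻¹ |e^{tS} x - ξ|²)`. -/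
noncomputable def heatKernel {d N : ℕ} (A B : CMat N) (S : RMat d) (x ξ : RSpace d) (t : ℝ) :
    CMat N :=
  kernelK A B (rot S t x - ξ) t

/-- A complex matrix acting on `ℂ^N`. -/
noncomputable abbrev act {N : ℕ} (C : CMat N) : CSpace N →L[ℂ] CSpace N :=
  Matrix.toEuclideanCLM (n := Fin N) (𝕜 := ℂ) C

/-- The function `T(t)v`: `[T(t)v](x) = ∫ H(x, ξ, t) v(ξ) dξ` for `t > 0`, and `T(0)v = v`.
Negative times play no role. -/
noncomputable def semigroupFun {d N : ℕ} (A B : CMat N) (S : RMat d) (t : ℝ)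
    (v : RSpace d → CSpace N) (x : RSpace d) : CSpace N :=
  if 0 < t then ∫ ξ, act (heatKernel A B S x ξ t) (v ξ) else v x

end Kernel

section Crub

/-- `C_rub(ℝ^d, F)` as a subspace of `C_b(ℝ^d, F)` (with the supremum norm): the bounded
uniformly continuous `v` with `sup_x |v(e^{-tS} x) - v(x)| → 0` as `t → 0`. -/
noncomputable def Crub {d : ℕ} (S : RMat d) (F : Type*) [NormedAddCommGroup F] [NormedSpace ℂ F] :
    Submodule ℂ (RSpace d →ᵇ F) where
  carrier := {v | UniformContinuous v ∧
    TendstoUniformly (fun (t : ℝ) (x : RSpace d) => v (rot S (-t) x)) v (𝓝 0)}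
  add_mem' := fun hu hv => ⟨hu.1.add hv.1, hu.2.add hv.2⟩
  zero_mem' := ⟨uniformContinuous_const, fun _ hU => Eventually.of_forall fun _ _ =>
    refl_mem_uniformity hU⟩
  smul_mem' := fun c _ hv => ⟨hv.1.const_smul c,
    (uniformContinuous_const_smul c).comp_tendstoUniformly hv.2⟩

/-- `C_rub` is closed in `C_b`. -/
theorem isClosed_Crub {d : ℕ} (S : RMat d) (F : Type*) [NormedAddCommGroup F] [NormedSpace ℂ F] :
    IsClosed (Crub S F : Set (RSpace d →ᵇ F)) := by
  rw [← isSeqClosed_iff_isClosed]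
  intro u v hu huv
  rw [BoundedContinuousFunction.tendsto_iff_tendstoUniformly] at huv
  refine ⟨huv.uniformContinuous (Eventually.of_forall fun n => (hu n).1).frequently, ?_⟩
  rw [Metric.tendstoUniformly_iff] at huv ⊢
  intro ε hε
  obtain ⟨n, hn⟩ := (huv (ε / 3) (by positivity)).exists
  filter_upwards [Metric.tendstoUniformly_iff.1 (hu n).2 (ε / 3) (by positivity)] with t ht x
  have h1 := hn x
  have h2 := hn (rot S (-t) x)
  have h3 := ht x
  rw [dist_comm] at h2
  linarith [dist_triangle4 (v x) (u n x) (u n (rot S (-t) x)) (v (rot S (-t) x))]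

/-- `C_rub` is a Banach space. -/
instance {d : ℕ} (S : RMat d) (F : Type*) [NormedAddCommGroup F] [NormedSpace ℂ F]
    [CompleteSpace F] : CompleteSpace (Crub S F) :=
  (isClosed_Crub S F).completeSpace_coe

end Crub

section Semigroup

variable {d N : ℕ} {A B Y : CMat N} {S : RMat d}

theorem rot_neg_star (hS : S.transpose = -S) (t : ℝ) : star (rot S t) = rot S (-t) := by
  unfold rot
  rw [← map_star, Matrix.star_eq_conjTranspose, Matrix.conjTranspose_eq_transpose_of_trivial,
    ← Matrix.exp_transpose, Matrix.transpose_smul, hS, smul_neg, neg_smul]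

theorem rot_mul (s t : ℝ) : rot S s * rot S t = rot S (s + t) := by
  unfold rot
  rw [← map_mul, ← Matrix.exp_add_of_commute _ _
    (((Commute.refl S).smul_left s).smul_right t), add_smul]

theorem rot_rot (s t : ℝ) (x : RSpace d) : rot S s (rot S t x) = rot S (s + t) x := by
  rw [← rot_mul]; rfl

theorem rot_zero (x : RSpace d) : rot S 0 x = x := by
  simp [rot]

theorem norm_rot (hS : S.transpose = -S) (t : ℝ) (x : RSpace d) : ‖rot S t x‖ = ‖x‖ := by
  refine (rot S t).norm_map_iff_adjoint_comp_self.2 ?_ x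
  rw [← ContinuousLinearMap.star_eq_adjoint, rot_neg_star hS]
  ext1 y
  change rot S (-t) (rot S t y) = y
  rw [rot_rot, neg_add_cancel, rot_zero]

/-- The rotation as a linear isometry equivalence, for skew-symmetric `S`. -/
noncomputable def rotEquiv (hS : S.transpose = -S) (t : ℝ) : RSpace d ≃ₗᵢ[ℝ] RSpace d where
  toFun := rot S t
  map_add' := map_add _
  map_smul' := map_smul _
  invFun := rot S (-t)
  left_inv := fun x => by rw [rot_rot, neg_add_cancel, rot_zero]
  right_inv := fun x => by rw [rot_rot, add_neg_cancel, rot_zero]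
  norm_map' := norm_rot hS t

theorem Assumptions.exists_diag (h : Assumptions A B Y S) :
    ∃ a b : Fin N → ℂ, A = Y * Matrix.diagonal a * Y⁻¹ ∧ B = Y * Matrix.diagonal b * Y⁻¹ ∧
      ∀ i, 0 < (a i).re := by
  have hdet : IsUnit Y.det := (Matrix.isUnit_iff_isUnit_det Y).1 h.isUnit_Y
  have hYY' : Y * Y⁻¹ = 1 := Matrix.mul_nonsing_inv Y hdet
  have key : ∀ C : CMat N, (Y⁻¹ * C * Y).IsDiag →
      C = Y * Matrix.diagonal (Y⁻¹ * C * Y).diag * Y⁻¹ := by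
    intro C hC
    rw [hC.diagonal_diag]
    calc C = (Y * Y⁻¹) * C * (Y * Y⁻¹) := by rw [hYY', one_mul, mul_one]
      _ = _ := by simp only [mul_assoc]
  have hspec : ∀ a : Fin N → ℂ, spectrum ℂ (Y * Matrix.diagonal a * Y⁻¹) = Set.range a := by
    intro a
    obtain ⟨U, rfl⟩ := h.isUnit_Y
    rw [← Matrix.coe_units_inv, spectrum.units_conjugate, spectrum_diagonal]
  refine ⟨_, _, key A h.diag_A, key B h.diag_B, fun i => h.spec_A _ ?_⟩
  have hA := hspec (Y⁻¹ * A * Y).diag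
  rw [← key A h.diag_A] at hA
  rw [hA]
  exact ⟨i, rfl⟩

theorem inv_conj_diagonal (hY : IsUnit Y) (a : Fin N → ℂ) (ha : ∀ i, a i ≠ 0) :
    (Y * Matrix.diagonal a * Y⁻¹)⁻¹ = Y * Matrix.diagonal (fun i => (a i)⁻¹) * Y⁻¹ := by
  have hdet : IsUnit Y.det := (Matrix.isUnit_iff_isUnit_det Y).1 hY
  have hYY : Y⁻¹ * Y = 1 := Matrix.nonsing_inv_mul Y hdet
  have hYY' : Y * Y⁻¹ = 1 := Matrix.mul_nonsing_inv Y hdet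
  refine Matrix.inv_eq_right_inv ?_
  calc _ = Y * Matrix.diagonal a * (Y⁻¹ * Y) * Matrix.diagonal (fun i => (a i)⁻¹) * Y⁻¹ := by
          simp only [mul_assoc]
    _ = Y * (Matrix.diagonal a * Matrix.diagonal (fun i => (a i)⁻¹)) * Y⁻¹ := by
          rw [hYY]; simp only [mul_assoc, one_mul]
    _ = 1 := by
          rw [Matrix.diagonal_mul_diagonal]
          simp [ha, hYY']

/-- The kernel in diagonalized form. -/
theorem kernelK_eq {a b : Fin N → ℂ} (hY : IsUnit Y) (hA : A = Y * Matrix.diagonal a * Y⁻¹)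
    (hB : B = Y * Matrix.diagonal b * Y⁻¹) (ha : ∀ i, a i ≠ 0) {t : ℝ} (ht : 0 < t)
    (ψ : RSpace d) :
    kernelK A B ψ t = Y * Matrix.diagonal (fun i =>
      (4 * Real.pi * t * a i) ^ (-(d : ℂ) / 2) *
        Complex.exp (-(t * b i) - (‖ψ‖ ^ 2 : ℝ) * (4 * t * a i)⁻¹)) * Y⁻¹ := by
  have hdet : IsUnit Y.det := (Matrix.isUnit_iff_isUnit_det Y).1 hY
  have hYY : Y⁻¹ * Y = 1 := Matrix.nonsing_inv_mul Y hdet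
  have hsmul : ∀ (c : ℂ) (u : Fin N → ℂ), c • (Y * Matrix.diagonal u * Y⁻¹)
      = Y * Matrix.diagonal (fun i => c * u i) * Y⁻¹ := by
    intro c u
    rw [← smul_mul_assoc, ← mul_smul_comm, ← Matrix.diagonal_smul]
    rfl
  have hne : ∀ i, (4 * t : ℂ) * a i ≠ 0 := fun i =>
    mul_ne_zero (mul_ne_zero (by norm_num) (by exact_mod_cast ht.ne')) (ha i)
  have hexp : -((t : ℂ) • B) - ((‖ψ‖ ^ 2 : ℝ) : ℂ) • ((4 * t : ℂ) • A)⁻¹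
      = Y * Matrix.diagonal (fun i => -(t * b i) - (‖ψ‖ ^ 2 : ℝ) * (4 * t * a i)⁻¹) * Y⁻¹ := by
    rw [hA, hB, hsmul, hsmul, inv_conj_diagonal hY _ hne, hsmul]
    rw [← neg_mul, ← mul_neg, ← sub_mul, ← mul_sub, Matrix.diagonal_neg, Matrix.diagonal_sub]
  rw [kernelK, hexp, hA, hsmul, matrixCpow_conj_diagonal Y hY, Matrix.exp_conj _ _ hY,
    Matrix.exp_diagonal]
  calc _ = Y * Matrix.diagonal (fun i => (4 * Real.pi * t * a i) ^ (-(d : ℂ) / 2)) * (Y⁻¹ * Y) *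
        Matrix.diagonal (NormedSpace.exp
          (fun i => -(t * b i) - (‖ψ‖ ^ 2 : ℝ) * (4 * t * a i)⁻¹)) * Y⁻¹ := by
          simp only [mul_assoc]
    _ = _ := by
          rw [hYY, mul_one, mul_assoc Y, Matrix.diagonal_mul_diagonal]
          congr 3
          funext i
          rw [Pi.coe_exp, Complex.exp_eq_exp_ℂ]

theorem integrable_gaussian (d : ℕ) {z : ℂ} (hz : 0 < z.re) (c w : ℂ) :
    Integrable (fun ψ : RSpace d => c * Complex.exp (w - (‖ψ‖ ^ 2 : ℝ) * z)) := by
  have h1 := ((GaussianFourier.integrable_cexp_neg_mul_sq_norm_add (V := RSpace d) hz 0 0).const_mul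
    (Complex.exp w)).const_mul c
  refine h1.congr (Eventually.of_forall fun ψ => ?_)
  simp only [zero_mul, add_zero]
  rw [← Complex.exp_add]
  congr 2
  push_cast
  ring

theorem integrable_sum_smul {α E : Type*} [MeasurableSpace α] {μ : Measure α}
    [NormedAddCommGroup E] [NormedSpace ℂ E] (f : Fin N → α → ℂ) (hf : ∀ i, Integrable (f i) μ)
    (L : Fin N → E) : Integrable (fun x => ∑ i, f i x • L i) μ :=
  integrable_finsetSum _ fun i _ => (hf i).smul_const (L i)

theorem integrable_kernelK (h : Assumptions A B Y S) {t : ℝ} (ht : 0 < t) :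
    Integrable (fun ψ : RSpace d => act (kernelK A B ψ t)) := by
  obtain ⟨a, b, hA, hB, ha⟩ := h.exists_diag
  have ha' : ∀ i, a i ≠ 0 := fun i h0 => by simpa [h0] using ha i
  have hre : ∀ i, 0 < ((4 * t * a i : ℂ)⁻¹).re := by
    intro i
    rw [Complex.inv_re]
    have h1 : (4 * t * a i : ℂ).re = 4 * t * (a i).re := by
      have : (4 * t * a i : ℂ) = ((4 * t : ℝ) : ℂ) * a i := by push_cast; ring
      rw [this, Complex.re_ofReal_mul]
    refine div_pos (by rw [h1]; have := ha i; positivity) (Complex.normSq_pos.2 ?_)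
    exact mul_ne_zero (mul_ne_zero (by norm_num) (by exact_mod_cast ht.ne')) (ha' i)
  have hsum := integrable_sum_smul _ (fun i => integrable_gaussian d (hre i)
    ((4 * Real.pi * t * a i) ^ (-(d : ℂ) / 2)) (-(t * b i)))
    (fun i => act (Y * Matrix.single i i 1 * Y⁻¹))
  refine hsum.congr (Eventually.of_forall fun ψ => ?_)
  simp only
  rw [kernelK_eq h.isUnit_Y hA hB ha' ht, ← Matrix.sum_single_eq_diagonal, Finset.mul_sum,
    Finset.sum_mul]
  refine Eq.trans ?_ (map_sum (Matrix.toEuclideanCLM (n := Fin N) (𝕜 := ℂ)) _ _).symm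
  refine Finset.sum_congr rfl fun i _ => ?_
  refine (map_smul (Matrix.toEuclideanCLM (n := Fin N) (𝕜 := ℂ)) _ _).symm.trans ?_
  rw [← smul_mul_assoc, ← mul_smul_comm, Matrix.smul_single, smul_eq_mul, mul_one]

theorem integrable_act_apply {F : RSpace d → CSpace N →L[ℂ] CSpace N} (hF : Integrable F)
    (v : RSpace d →ᵇ CSpace N) (L : RSpace d → RSpace d) (hL : Continuous L) :
    Integrable (fun ψ => F ψ (v (L ψ))) := by
  refine (hF.norm.mul_const ‖v‖).mono' ?_ (Eventually.of_forall fun ψ => ?_)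
  · exact (ContinuousLinearMap.apply ℂ (CSpace N)).flip.aestronglyMeasurable_comp₂
      hF.aestronglyMeasurable (v.continuous.comp hL).aestronglyMeasurable
  · exact (ContinuousLinearMap.le_opNorm _ _).trans
      (mul_le_mul_of_nonneg_left (v.norm_coe_le_norm _) (norm_nonneg _))

theorem integrable_heatKernel (h : Assumptions A B Y S) {t : ℝ} (ht : 0 < t)
    (v : RSpace d →ᵇ CSpace N) (x : RSpace d) :
    Integrable (fun ξ => act (heatKernel A B S x ξ t) (v ξ)) :=
  integrable_act_apply ((integrable_kernelK h ht).comp_sub_left (rot S t x)) v id continuous_id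

theorem semigroupFun_eq {t : ℝ} (ht : 0 < t) (v : RSpace d → CSpace N) (x : RSpace d) :
    semigroupFun A B S t v x = ∫ ψ, act (kernelK A B ψ t) (v (rot S t x - ψ)) := by
  rw [semigroupFun, if_pos ht,
    ← integral_sub_left_eq_self (fun ξ => act (heatKernel A B S x ξ t) (v ξ)) volume (rot S t x)]
  simp [heatKernel]

/-- The kernel only depends on `|ψ|`. -/
theorem kernelK_rot (hS : S.transpose = -S) (s t : ℝ) (ψ : RSpace d) :
    kernelK A B (rot S s ψ) t = kernelK A B ψ t := by
  simp only [kernelK, norm_rot hS]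

theorem norm_semigroupFun_sub_le (h : Assumptions A B Y S) {t : ℝ} (ht : 0 < t)
    (u v : RSpace d →ᵇ CSpace N) (L : RSpace d → RSpace d) (hL : Continuous L)
    (x : RSpace d) (δ : ℝ)
    (hδ : ∀ ψ, ‖u (L ψ) - v (rot S t x - ψ)‖ ≤ δ) :
    ‖(∫ ψ, act (kernelK A B ψ t) (u (L ψ))) - semigroupFun A B S t v x‖
      ≤ (∫ ψ : RSpace d, ‖act (kernelK A B ψ t)‖) * δ := by
  have hK := integrable_kernelK h ht
  have h2 := integrable_act_apply hK v (fun ψ => rot S t x - ψ) (by fun_prop)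
  rw [semigroupFun_eq ht, ← integral_sub (integrable_act_apply hK u L hL) h2, ← integral_mul_const]
  refine norm_integral_le_of_norm_le (hK.norm.mul_const δ) (Eventually.of_forall fun ψ => ?_)
  rw [← map_sub]
  exact (ContinuousLinearMap.le_opNorm _ _).trans
    (mul_le_mul_of_nonneg_left (hδ ψ) (norm_nonneg _))

theorem norm_semigroupFun_le (h : Assumptions A B Y S) {t : ℝ} (ht : 0 < t)
    (v : RSpace d →ᵇ CSpace N) (x : RSpace d) :
    ‖semigroupFun A B S t v x‖ ≤ (∫ ψ : RSpace d, ‖act (kernelK A B ψ t)‖) * ‖v‖ := by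
  have := norm_semigroupFun_sub_le h ht 0 v id continuous_id x ‖v‖
    (fun ψ => by simpa using v.norm_coe_le_norm _)
  simpa using this

theorem uniformContinuous_semigroupFun (h : Assumptions A B Y S) {t : ℝ} (ht : 0 < t)
    (v : RSpace d →ᵇ CSpace N) (hv : UniformContinuous v) :
    UniformContinuous (semigroupFun A B S t v) := by
  set C := ∫ ψ : RSpace d, ‖act (kernelK A B ψ t)‖ with hC
  have hC0 : 0 ≤ C := integral_nonneg fun _ => norm_nonneg _
  rw [Metric.uniformContinuous_iff] at hv ⊢
  intro ε hε
  obtain ⟨δ, hδ, H⟩ := hv (ε / (C + 1)) (by positivity)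
  refine ⟨δ, hδ, fun {x y} hxy => ?_⟩
  rw [dist_eq_norm, semigroupFun_eq ht (x := x)]
  refine (norm_semigroupFun_sub_le h ht v v (fun ψ => rot S t x - ψ) (by fun_prop) y
    (ε / (C + 1)) fun ψ => ?_).trans_lt ?_
  · rw [← dist_eq_norm]
    refine (H ?_).le
    rwa [dist_sub_right, dist_eq_norm, ← map_sub, norm_rot h.skew_S, ← dist_eq_norm]
  · rw [← hC, mul_div_assoc', div_lt_iff₀ (by positivity)]
    nlinarith

theorem tendstoUniformly_semigroupFun (h : Assumptions A B Y S) {t : ℝ} (ht : 0 < t)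
    (v : RSpace d →ᵇ CSpace N)
    (hv : TendstoUniformly (fun (s : ℝ) (x : RSpace d) => v (rot S (-s) x)) v (𝓝 0)) :
    TendstoUniformly (fun (s : ℝ) (x : RSpace d) => semigroupFun A B S t v (rot S (-s) x))
      (semigroupFun A B S t v) (𝓝 0) := by
  set C := ∫ ψ : RSpace d, ‖act (kernelK A B ψ t)‖ with hC
  have hC0 : 0 ≤ C := integral_nonneg fun _ => norm_nonneg _
  rw [Metric.tendstoUniformly_iff] at hv ⊢
  intro ε hε
  filter_upwards [hv (ε / (C + 1)) (by positivity)] with s hs x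
  have hrot : semigroupFun A B S t v (rot S (-s) x)
      = ∫ ψ, act (kernelK A B ψ t) (v (rot S (-s) (rot S t x - ψ))) := by
    rw [semigroupFun_eq ht, ← (rotEquiv h.skew_S (-s)).measurePreserving.integral_comp
      (rotEquiv h.skew_S (-s)).toHomeomorph.measurableEmbedding]
    refine integral_congr_ae (Eventually.of_forall fun ψ => ?_)
    change act (kernelK A B (rot S (-s) ψ) t) (v (rot S t (rot S (-s) x) - rot S (-s) ψ)) = _
    simp only []
    rw [kernelK_rot h.skew_S, (rot S (-s)).map_sub, rot_rot, rot_rot, add_comm]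
  rw [dist_comm, dist_eq_norm, hrot]
  refine (norm_semigroupFun_sub_le h ht v v _ (by fun_prop) x
    (ε / (C + 1)) fun ψ => ?_).trans_lt ?_
  · rw [← dist_eq_norm, dist_comm]
    exact (hs _).le
  · rw [← hC, mul_div_assoc', div_lt_iff₀ (by positivity)]
    nlinarith

/-- The Ornstein-Uhlenbeck semigroup `(T(t))_{t ≥ 0}` on `C_rub(ℝ^d, ℂ^N)`. -/
noncomputable def semigroup (h : Assumptions A B Y S) (t : ℝ) : Crub S (CSpace N) →L[ℂ] Crub S (CSpace N) :=
  if ht : 0 < t then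
    LinearMap.mkContinuous
      { toFun := fun v =>
          ⟨BoundedContinuousFunction.ofNormedAddCommGroup (semigroupFun A B S t v.1)
            (uniformContinuous_semigroupFun h ht v.1 v.2.1).continuous _
            (norm_semigroupFun_le h ht v.1),
            uniformContinuous_semigroupFun h ht v.1 v.2.1,
            tendstoUniformly_semigroupFun h ht v.1 v.2.2⟩
        map_add' := fun u v => by
          ext1; ext1 x
          change semigroupFun A B S t (u.1 + v.1) x
            = semigroupFun A B S t u.1 x + semigroupFun A B S t v.1 x
          simp only [semigroupFun, if_pos ht]
          rw [← integral_add (integrable_heatKernel h ht u.1 x) (integrable_heatKernel h ht v.1 x)]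
          simp
        map_smul' := fun c v => by
          ext1; ext1 x
          change semigroupFun A B S t (c • v.1) x = c • semigroupFun A B S t v.1 x
          simp only [semigroupFun, if_pos ht]
          rw [← integral_smul]
          simp }
      (∫ ψ : RSpace d, ‖act (kernelK A B ψ t)‖)
      (fun v => (BoundedContinuousFunction.norm_le
        (mul_nonneg (integral_nonneg fun _ => norm_nonneg _) (norm_nonneg _))).2
        (norm_semigroupFun_le h ht v.1))
  else ContinuousLinearMap.id ℂ (Crub S (CSpace N))

/-- `T(t)v` is the function given by the heat kernel formula. -/
theorem semigroup_apply (h : Assumptions A B Y S) (t : ℝ) (v : Crub S (CSpace N)) (x : RSpace d) :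
    (semigroup h t v).1 x = semigroupFun A B S t v.1 x := by
  unfold semigroup
  split_ifs with ht
  · rfl
  · simp [semigroupFun, ht]

end Semigroup

section Generator

/-- The infinitesimal generator of a one-parameter family `(T(t))_{t ≥ 0}` of bounded operators:
its domain consists of all `v` for which `(T(t)v - v)/t` converges in norm as `t ↓ 0`,
and its value at such a `v` is the limit. -/
noncomputable def generator {X : Type*} [NormedAddCommGroup X] [NormedSpace ℂ X]
    (T : ℝ → X →L[ℂ] X) : X →ₗ.[ℂ] X where
  domain :=
    { carrier := {v | ∃ w, Tendsto (fun t : ℝ => (t : ℂ)⁻¹ • (T t v - v)) (𝓝[>] 0) (𝓝 w)}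
      add_mem' := by
        rintro u v ⟨w, hw⟩ ⟨z, hz⟩
        refine ⟨w + z, (hw.add hz).congr fun t => ?_⟩
        rw [map_add, ← smul_add]
        congr 1
        abel
      zero_mem' := ⟨0, by simp⟩
      smul_mem' := by
        rintro c v ⟨w, hw⟩
        refine ⟨c • w, (hw.const_smul c).congr fun t => ?_⟩
        rw [map_smul, smul_comm, smul_sub] }
  toFun :=
    { toFun := fun v => v.2.choose
      map_add' := fun u v => by
        refine tendsto_nhds_unique (u + v).2.choose_spec
          ((u.2.choose_spec.add v.2.choose_spec).congr fun t => ?_)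
        rw [Submodule.coe_add, map_add, ← smul_add]
        congr 1
        abel
      map_smul' := fun c v => by
        refine tendsto_nhds_unique (c • v).2.choose_spec
          ((v.2.choose_spec.const_smul c).congr fun t => ?_)
        rw [Submodule.coe_smul, map_smul, smul_comm, smul_sub] }

/-- The value of the generator is the limit of the difference quotients. -/
theorem generator_tendsto {X : Type*} [NormedAddCommGroup X] [NormedSpace ℂ X]
    (T : ℝ → X →L[ℂ] X) (v : (generator T).domain) :
    Tendsto (fun t : ℝ => (t : ℂ)⁻¹ • (T t (v : X) - (v : X))) (𝓝[>] 0) (𝓝 (generator T v)) :=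
  v.2.choose_spec

/-- The generator `A_b` of the Ornstein-Uhlenbeck semigroup on `C_rub(ℝ^d, ℂ^N)`. -/
noncomputable def Ab {d N : ℕ} {A B Y : CMat N} {S : RMat d} (h : Assumptions A B Y S) :
    Crub S (CSpace N) →ₗ.[ℂ] Crub S (CSpace N) :=
  generator (X := Crub S (CSpace N)) (semigroup h)

end Generator

end OrnsteinUhlenbeck

/-!
In the basis `Y` the kernel `K(ψ, t)` is a diagonal matrix of scalar complex Gaussians, so
everything about it reduces to scalar computations: its `L¹` norm is at most `M_b e^{ω_b t}`,
`K(·, s)` and `K(·, t)` convolve to `K(·, s + t)` (complete the square), and `K(·, t)` is an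
approximate identity as `t ↓ 0`. Since `K(ψ, t)` depends only on `|ψ|`, convolution with it
commutes with the isometries `e^{tS}`; hence `T` is a strongly continuous semigroup of type
`(M_b, ω_b)` on `C_rub`.

For any such semigroup put `R(λ)v = ∫₀^∞ e^{-λt} T(t)v dt`. Shifting the integration variable
gives `T(h)R(λ)v = e^{λh} (R(λ)v - ∫₀^h e^{-λt} T(t)v dt)`, whose right derivative at `h = 0` is
`λ R(λ)v - v`. So `R(λ)` is a right inverse of `λ - A_b`, and a left inverse because it commutes
with every `T(h)`.
-/

namespace OrnsteinUhlenbeck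

section C0Semigroup

variable {X : Type*} [NormedAddCommGroup X] [NormedSpace ℂ X]

/-- A strongly continuous semigroup of bounded operators of growth type `(M, ω)`. Only the values
of `T` at nonnegative times matter. The growth bound is only asked for at positive times; at `0` it
follows by strong continuity. -/
structure IsC0Semigroup (T : ℝ → X →L[ℂ] X) (M ω : ℝ) : Prop where
  protected map_zero : T 0 = 1
  protected map_add {s t : ℝ} (hs : 0 ≤ s) (ht : 0 ≤ t) : T (s + t) = T s * T t
  opNorm_le {t : ℝ} (ht : 0 < t) : ‖T t‖ ≤ M * Real.exp (ω * t)
  tendsto_zero (v : X) : Tendsto (fun t => T t v) (𝓝[>] 0) (𝓝 v)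

theorem mem_domain_generator_of_tendsto {T : ℝ → X →L[ℂ] X} {v w : X}
    (hvw : Tendsto (fun t : ℝ => (t : ℂ)⁻¹ • (T t v - v)) (𝓝[>] 0) (𝓝 w)) :
    v ∈ (generator T).domain :=
  ⟨w, hvw⟩

theorem generator_eq_of_tendsto {T : ℝ → X →L[ℂ] X} {v : (generator T).domain} {w : X}
    (hvw : Tendsto (fun t : ℝ => (t : ℂ)⁻¹ • (T t v - (v : X))) (𝓝[>] 0) (𝓝 w)) :
    generator T v = w :=
  tendsto_nhds_unique (generator_tendsto T v) hvw

namespace IsC0Semigroup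

variable {T : ℝ → X →L[ℂ] X} {M ω : ℝ}

theorem apply_add (hT : IsC0Semigroup T M ω) {s t : ℝ} (hs : 0 ≤ s) (ht : 0 ≤ t) (v : X) :
    T (s + t) v = T s (T t v) := by
  rw [hT.map_add hs ht, mul_apply_eq_comp]

theorem norm_apply_le (hT : IsC0Semigroup T M ω) {t : ℝ} (ht : 0 ≤ t) (v : X) :
    ‖T t v‖ ≤ M * Real.exp (ω * t) * ‖v‖ := by
  rcases ht.eq_or_lt with rfl | ht
  · have hbound : Tendsto (fun t => M * Real.exp (ω * t) * ‖v‖) (𝓝[>] 0)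
        (𝓝 (M * Real.exp (ω * 0) * ‖v‖)) :=
      (Continuous.tendsto (by fun_prop) 0).mono_left nhdsWithin_le_nhds
    rw [hT.map_zero]
    exact le_of_tendsto_of_tendsto (hT.tendsto_zero v).norm hbound
      (eventually_mem_nhdsWithin.mono fun t ht => (T t).le_of_opNorm_le (hT.opNorm_le ht) v)
  · exact (T t).le_of_opNorm_le (hT.opNorm_le ht) v

theorem norm_apply_sub_apply_le (hT : IsC0Semigroup T M ω) {s t : ℝ} (hs : 0 ≤ s) (ht : 0 ≤ t)
    (v : X) :
    ‖T s v - T t v‖ ≤ M * Real.exp (ω * min s t) * ‖T |s - t| v - v‖ := by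
  wlog hst : t ≤ s generalizing s t
  · rw [norm_sub_rev, min_comm, abs_sub_comm]
    exact this ht hs (le_of_not_ge hst)
  have hsplit : T s v = T t (T (s - t) v) := by
    rw [← hT.apply_add ht (sub_nonneg.2 hst), add_sub_cancel]
  rw [min_eq_right hst, abs_of_nonneg (sub_nonneg.2 hst), hsplit, ← map_sub]
  exact hT.norm_apply_le ht _

theorem continuousOn_apply (hT : IsC0Semigroup T M ω) (v : X) :
    ContinuousOn (fun t => T t v) (Ici 0) := by
  intro t ht
  have hright : Tendsto (fun r => T r v) (𝓝[≥] 0) (𝓝 v) := by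
    rw [← Ioi_insert, nhdsWithin_insert, tendsto_sup, tendsto_pure_left]
    exact ⟨fun s hs => by simpa [hT.map_zero] using mem_of_mem_nhds hs, hT.tendsto_zero v⟩
  have habs : Tendsto (fun s : ℝ => |s - t|) (𝓝[Ici 0] t) (𝓝[≥] 0) := by
    refine tendsto_nhdsWithin_iff.2 ⟨?_, Eventually.of_forall fun s => mem_Ici.2 (abs_nonneg _)⟩
    simpa using (Continuous.tendsto (f := fun s : ℝ => |s - t|) (by fun_prop) t).mono_left
      nhdsWithin_le_nhds
  have hfactor : Tendsto (fun s => M * Real.exp (ω * min s t)) (𝓝[Ici 0] t)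
      (𝓝 (M * Real.exp (ω * min t t))) :=
    (Continuous.tendsto (by fun_prop) t).mono_left nhdsWithin_le_nhds
  have hbound := hfactor.mul (tendsto_iff_norm_sub_tendsto_zero.1 (hright.comp habs))
  rw [mul_zero] at hbound
  exact tendsto_iff_norm_sub_tendsto_zero.2 <| squeeze_zero'
    (Eventually.of_forall fun _ => norm_nonneg _)
    (eventually_mem_nhdsWithin.mono fun s hs => hT.norm_apply_sub_apply_le hs ht v) hbound

theorem continuousOn_exp_smul (hT : IsC0Semigroup T M ω) (lam : ℂ) (v : X) :
    ContinuousOn (fun t : ℝ => Complex.exp (-lam * t) • T t v) (Ici 0) :=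
  (Continuous.continuousOn (by fun_prop)).smul (hT.continuousOn_apply v)

theorem norm_exp_smul_le (hT : IsC0Semigroup T M ω) (lam : ℂ) (v : X) {t : ℝ} (ht : 0 ≤ t) :
    ‖Complex.exp (-lam * t) • T t v‖ ≤ M * ‖v‖ * Real.exp (-(lam.re - ω) * t) :=
  calc ‖Complex.exp (-lam * t) • T t v‖ = Real.exp (-lam.re * t) * ‖T t v‖ := by
        rw [norm_smul, Complex.norm_exp, Complex.re_mul_ofReal, Complex.neg_re]
    _ ≤ Real.exp (-lam.re * t) * (M * Real.exp (ω * t) * ‖v‖) := by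
        gcongr
        exact hT.norm_apply_le ht v
    _ = M * ‖v‖ * (Real.exp (-lam.re * t) * Real.exp (ω * t)) := by ring
    _ = M * ‖v‖ * Real.exp (-(lam.re - ω) * t) := by
        rw [← Real.exp_add]
        ring_nf

theorem integrableOn_exp_smul (hT : IsC0Semigroup T M ω) {lam : ℂ} (hlam : ω < lam.re) (v : X) :
    IntegrableOn (fun t : ℝ => Complex.exp (-lam * t) • T t v) (Ioi 0) := by
  refine ((exp_neg_integrableOn_Ioi 0 (sub_pos.2 hlam)).const_mul (M * ‖v‖)).mono'
    (((hT.continuousOn_exp_smul lam v).mono Ioi_subset_Ici_self).aestronglyMeasurable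
      measurableSet_Ioi) ?_
  filter_upwards [ae_restrict_mem measurableSet_Ioi] with t ht
  exact hT.norm_exp_smul_le lam v (mem_Ioi.1 ht).le

theorem norm_integral_exp_smul_le (hT : IsC0Semigroup T M ω) {lam : ℂ} (hlam : ω < lam.re)
    (v : X) :
    ‖∫ t in Ioi (0 : ℝ), Complex.exp (-lam * t) • T t v‖ ≤ M / (lam.re - ω) * ‖v‖ := by
  have hpos := sub_pos.2 hlam
  calc ‖∫ t in Ioi (0 : ℝ), Complex.exp (-lam * t) • T t v‖
      ≤ ∫ t in Ioi (0 : ℝ), M * ‖v‖ * Real.exp (-(lam.re - ω) * t) := by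
        refine norm_integral_le_of_norm_le
          ((exp_neg_integrableOn_Ioi 0 hpos).const_mul (M * ‖v‖)) ?_
        filter_upwards [ae_restrict_mem measurableSet_Ioi] with t ht
        exact hT.norm_exp_smul_le lam v (mem_Ioi.1 ht).le
    _ = M / (lam.re - ω) * ‖v‖ := by
        rw [integral_const_mul, integral_exp_mul_Ioi (neg_lt_zero.2 hpos), mul_zero, Real.exp_zero]
        field_simp

/-- The Laplace transform `R(λ) v = ∫₀^∞ e^{-λt} T(t) v dt` of a semigroup of growth type `(M, ω)`,
as a bounded operator, for `Re λ > ω`. It is the resolvent of the generator. -/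
noncomputable def laplace (hT : IsC0Semigroup T M ω) {lam : ℂ} (hlam : ω < lam.re) : X →L[ℂ] X :=
  LinearMap.mkContinuous
    { toFun := fun v => ∫ t in Ioi (0 : ℝ), Complex.exp (-lam * t) • T t v
      map_add' := fun u v => by
        rw [← integral_add (hT.integrableOn_exp_smul hlam u) (hT.integrableOn_exp_smul hlam v)]
        simp only [map_add, smul_add]
      map_smul' := fun c v => by
        rw [RingHom.id_apply, ← integral_smul]
        simp only [map_smul, smul_comm _ c] }
    (M / (lam.re - ω)) (hT.norm_integral_exp_smul_le hlam)

theorem laplace_apply (hT : IsC0Semigroup T M ω) {lam : ℂ} (hlam : ω < lam.re) (v : X) :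
    hT.laplace hlam v = ∫ t in Ioi (0 : ℝ), Complex.exp (-lam * t) • T t v :=
  rfl

variable [CompleteSpace X]

theorem apply_laplace_comm (hT : IsC0Semigroup T M ω) {lam : ℂ} (hlam : ω < lam.re) (v : X)
    {h : ℝ} (hh : 0 ≤ h) : T h (hT.laplace hlam v) = hT.laplace hlam (T h v) := by
  rw [laplace_apply, laplace_apply, ← (T h).integral_comp_comm (hT.integrableOn_exp_smul hlam v)]
  refine setIntegral_congr_fun measurableSet_Ioi fun t ht => ?_
  have ht : 0 ≤ t := (mem_Ioi.1 ht).le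
  rw [map_smul, ← hT.apply_add hh ht, ← hT.apply_add ht hh, add_comm]

theorem apply_laplace (hT : IsC0Semigroup T M ω) {lam : ℂ} (hlam : ω < lam.re) (v : X) {h : ℝ}
    (hh : 0 ≤ h) :
    T h (hT.laplace hlam v) = Complex.exp (lam * h) •
      (hT.laplace hlam v - ∫ t in (0 : ℝ)..h, Complex.exp (-lam * t) • T t v) := by
  have hint := hT.integrableOn_exp_smul hlam v
  have hsplit := intervalIntegral.integral_interval_add_Ioi hint
    (hint.mono_set (Ioi_subset_Ioi hh))
  have hshift := (measurePreserving_add_right volume h).setIntegral_preimage_emb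
    (measurableEmbedding_addRight h)
    (fun t : ℝ => Complex.exp (lam * h) • Complex.exp (-lam * t) • T t v) (Ioi h)
  rw [preimage_add_const_Ioi, sub_self] at hshift
  rw [laplace_apply, sub_eq_of_eq_add' hsplit.symm, ← (T h).integral_comp_comm hint,
    ← integral_smul, ← hshift]
  refine setIntegral_congr_fun measurableSet_Ioi fun t ht => ?_
  have hexp : Complex.exp (-lam * t)
      = Complex.exp (lam * h) * Complex.exp (-lam * (t + h : ℝ)) := by
    rw [← Complex.exp_add]
    push_cast
    ring_nf
  rw [map_smul, ← hT.apply_add hh (mem_Ioi.1 ht).le, add_comm h t, smul_smul, hexp]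

theorem hasDerivWithinAt_apply_laplace (hT : IsC0Semigroup T M ω) {lam : ℂ} (hlam : ω < lam.re)
    (v : X) :
    HasDerivWithinAt (fun h : ℝ => T h (hT.laplace hlam v)) (lam • hT.laplace hlam v - v)
      (Ici 0) 0 := by
  have hcont := hT.continuousOn_exp_smul lam v
  have hcont' := hcont.mono Ioi_subset_Ici_self
  have hintegral : HasDerivWithinAt (fun h : ℝ => ∫ t in (0 : ℝ)..h, Complex.exp (-lam * t) • T t v)
      (Complex.exp (-lam * (0 : ℝ)) • T 0 v) (Ici 0) 0 :=
    intervalIntegral.integral_hasDerivWithinAt_right (by simp) (t := Ioi 0)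
      ⟨Ioi 0, self_mem_nhdsWithin, hcont'.aestronglyMeasurable measurableSet_Ioi⟩
      ((hcont 0 self_mem_Ici).mono Ioi_subset_Ici_self)
  have hexp : HasDerivWithinAt (fun h : ℝ => Complex.exp (lam * h)) lam (Ici 0) 0 := by
    simpa using (((hasDerivAt_id ((0 : ℝ) : ℂ)).const_mul lam).cexp).comp_ofReal.hasDerivWithinAt
  refine ((hexp.smul (hintegral.const_sub (hT.laplace hlam v))).congr_of_mem
    (fun h hh => hT.apply_laplace hlam v hh) self_mem_Ici).congr_deriv ?_
  simp [hT.map_zero, neg_add_eq_sub]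

theorem tendsto_slope_apply_laplace (hT : IsC0Semigroup T M ω) {lam : ℂ} (hlam : ω < lam.re)
    (v : X) :
    Tendsto (fun h : ℝ => (h : ℂ)⁻¹ • (T h (hT.laplace hlam v) - hT.laplace hlam v)) (𝓝[>] 0)
      (𝓝 (lam • hT.laplace hlam v - v)) := by
  refine ((hasDerivWithinAt_iff_tendsto_slope' self_notMem_Ioi).1
    (hT.hasDerivWithinAt_apply_laplace hlam v).Ioi_of_Ici).congr fun h => ?_
  rw [slope_def_module, sub_zero, hT.map_zero, one_apply_eq_self,
    ← Complex.ofReal_inv, Complex.coe_smul]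

theorem laplace_mem_domain_generator (hT : IsC0Semigroup T M ω) {lam : ℂ} (hlam : ω < lam.re)
    (v : X) : hT.laplace hlam v ∈ (generator T).domain :=
  mem_domain_generator_of_tendsto (hT.tendsto_slope_apply_laplace hlam v)

theorem smul_laplace_sub_generator (hT : IsC0Semigroup T M ω) {lam : ℂ} (hlam : ω < lam.re)
    (v : X) :
    lam • hT.laplace hlam v
      - generator T ⟨hT.laplace hlam v, hT.laplace_mem_domain_generator hlam v⟩ = v := by
  have hgen := generator_eq_of_tendsto (v := ⟨_, hT.laplace_mem_domain_generator hlam v⟩)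
    (hT.tendsto_slope_apply_laplace hlam v)
  rw [hgen, sub_sub_cancel]

theorem laplace_smul_sub_generator (hT : IsC0Semigroup T M ω) {lam : ℂ} (hlam : ω < lam.re)
    (v : (generator T).domain) : hT.laplace hlam (lam • (v : X) - generator T v) = v := by
  have hgen : Tendsto (fun h : ℝ => (h : ℂ)⁻¹ • (T h (hT.laplace hlam v) - hT.laplace hlam v))
      (𝓝[>] 0) (𝓝 (hT.laplace hlam (generator T v))) := by
    refine (((hT.laplace hlam).continuous.tendsto _).comp (generator_tendsto T v)).congr' ?_
    filter_upwards [self_mem_nhdsWithin] with h hh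
    rw [Function.comp_apply, map_smul, map_sub, hT.apply_laplace_comm hlam _ (mem_Ioi.1 hh).le]
  rw [map_sub, map_smul, tendsto_nhds_unique hgen (hT.tendsto_slope_apply_laplace hlam v),
    sub_sub_cancel]

end IsC0Semigroup

end C0Semigroup

section ScalarKernel

theorem ofReal_mul_cpow {r : ℝ} (hr : 0 < r) (a w : ℂ) :
    ((r : ℂ) * a) ^ w = (r : ℂ) ^ w * a ^ w := by
  have hr0 : (r : ℂ) ≠ 0 := Complex.ofReal_ne_zero.2 hr.ne'
  rcases eq_or_ne a 0 with rfl | ha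
  · rcases eq_or_ne w 0 with rfl | hw
    · simp
    · simp [Complex.zero_cpow hw]
  · rw [Complex.cpow_def_of_ne_zero (mul_ne_zero hr0 ha), Complex.cpow_def_of_ne_zero hr0,
      Complex.cpow_def_of_ne_zero ha, Complex.log_ofReal_mul hr ha, Complex.ofReal_log hr.le,
      add_mul, Complex.exp_add]

theorem norm_sq_div_add_norm_sub_sq_div {V : Type*} [NormedAddCommGroup V] [InnerProductSpace ℝ V]
    {s t : ℝ} (hs : 0 < s) (ht : 0 < t) (φ ψ : V) :
    ‖ψ‖ ^ 2 / s + ‖φ - ψ‖ ^ 2 / t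
      = ‖ψ - (s / (s + t)) • φ‖ ^ 2 / (s * t / (s + t)) + ‖φ‖ ^ 2 / (s + t) := by
  have hst : s + t ≠ 0 := (add_pos hs ht).ne'
  rw [norm_sub_sq_real, norm_sub_sq_real, inner_smul_right, norm_smul, real_inner_comm,
    Real.norm_eq_abs, mul_pow, sq_abs]
  field_simp
  ring

/-- The scalar heat kernel `(4πta)^{-d/2} exp(-bt - |ψ|²/(4ta))`. The values of `kernelK A B` have
these as eigenvalues, with `a` and `b` running through the eigenvalues of `A` and `B`. -/
noncomputable def scalarKernel {d : ℕ} (a b : ℂ) (t : ℝ) (ψ : RSpace d) : ℂ :=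
  (4 * Real.pi * t * a) ^ (-(d : ℂ) / 2) *
    Complex.exp (-(t * b) - (‖ψ‖ ^ 2 : ℝ) * (4 * t * a)⁻¹)

variable {d : ℕ} {a b : ℂ} {s t : ℝ}

theorem re_four_mul_inv (a : ℂ) (t : ℝ) :
    ((4 * t * a : ℂ)⁻¹).re = a.re / ‖a‖ ^ 2 / (4 * t) := by
  have hfactor : (4 * t * a : ℂ)⁻¹ = (((4 * t)⁻¹ : ℝ) : ℂ) * a⁻¹ := by
    push_cast
    rw [mul_inv]
  rw [hfactor, Complex.re_ofReal_mul, Complex.inv_re, Complex.normSq_eq_norm_sq,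
    ← div_eq_inv_mul]

theorem re_four_mul_inv_pos (ha : 0 < a.re) (ht : 0 < t) : 0 < ((4 * t * a : ℂ)⁻¹).re := by
  have hnorm : 0 < ‖a‖ := ha.trans_le (Complex.re_le_norm a)
  rw [re_four_mul_inv]
  positivity

theorem integrable_scalarKernel (ha : 0 < a.re) (b : ℂ) (ht : 0 < t) :
    Integrable (scalarKernel (d := d) a b t) :=
  integrable_gaussian d (re_four_mul_inv_pos ha ht) _ _

theorem integral_scalarKernel (ha : 0 < a.re) (b : ℂ) (ht : 0 < t) :
    ∫ ψ : RSpace d, scalarKernel a b t ψ = Complex.exp (-(t * b)) := by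
  have hbase : (4 * Real.pi * t * a : ℂ) ≠ 0 := by
    simp [Real.pi_ne_zero, ht.ne', Complex.ne_zero_of_re_pos ha]
  have hsplit (ψ : RSpace d) : scalarKernel a b t ψ = (4 * Real.pi * t * a) ^ (-(d : ℂ) / 2) *
      Complex.exp (-(t * b)) * Complex.exp (-(4 * t * a : ℂ)⁻¹ * ‖ψ‖ ^ 2) := by
    rw [mul_assoc, ← Complex.exp_add, scalarKernel]
    congr 2
    push_cast
    ring
  have hinv : (Real.pi : ℂ) / (4 * t * a)⁻¹ = 4 * Real.pi * t * a := by
    rw [div_inv_eq_mul]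
    ring
  simp_rw [hsplit]
  rw [integral_const_mul, GaussianFourier.integral_cexp_neg_mul_sq_norm (re_four_mul_inv_pos ha ht),
    finrank_euclideanSpace_fin, hinv, mul_right_comm, ← Complex.cpow_add _ _ hbase, neg_div,
    neg_add_cancel, Complex.cpow_zero, one_mul]

/-- Completing the square in `ψ` turns the integrand of a convolution into a shifted kernel. -/
theorem scalarKernel_mul_scalarKernel_sub (a b : ℂ) (hs : 0 < s) (ht : 0 < t) (φ ψ : RSpace d) :
    scalarKernel a b s ψ * scalarKernel a b t (φ - ψ)
      = scalarKernel a 0 (s * t / (s + t)) (ψ - (s / (s + t)) • φ)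
        * scalarKernel a b (s + t) φ := by
  have hscale (r : ℝ) (hr : 0 < r) : (4 * Real.pi * r * a : ℂ) ^ (-(d : ℂ) / 2)
      = (4 * Real.pi * a) ^ (-(d : ℂ) / 2) * (r : ℂ) ^ (-(d : ℂ) / 2) := by
    rw [mul_right_comm, mul_comm _ (r : ℂ), ofReal_mul_cpow hr, mul_comm]
  have hprefactors : (4 * Real.pi * s * a : ℂ) ^ (-(d : ℂ) / 2)
        * (4 * Real.pi * t * a) ^ (-(d : ℂ) / 2)
      = (4 * Real.pi * (s * t / (s + t) : ℝ) * a) ^ (-(d : ℂ) / 2)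
        * (4 * Real.pi * (s + t : ℝ) * a) ^ (-(d : ℂ) / 2) := by
    have hst : s * t / (s + t) * (s + t) = s * t := div_mul_cancel₀ _ (add_pos hs ht).ne'
    rw [hscale s hs, hscale t ht, hscale _ (by positivity), hscale (s + t) (by positivity),
      mul_mul_mul_comm, mul_mul_mul_comm _ (Complex.ofReal _ ^ _),
      ← Complex.mul_cpow_ofReal_nonneg hs.le ht.le,
      ← Complex.mul_cpow_ofReal_nonneg (by positivity) (by positivity), ← Complex.ofReal_mul,
      ← Complex.ofReal_mul, hst]
  have hexponents : -(s * b) - (‖ψ‖ ^ 2 : ℝ) * (4 * s * a)⁻¹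
        + (-(t * b) - (‖φ - ψ‖ ^ 2 : ℝ) * (4 * t * a)⁻¹)
      = -((s * t / (s + t) : ℝ) * 0)
        - (‖ψ - (s / (s + t)) • φ‖ ^ 2 : ℝ) * (4 * (s * t / (s + t) : ℝ) * a)⁻¹
        + (-((s + t : ℝ) * b) - (‖φ‖ ^ 2 : ℝ) * (4 * (s + t : ℝ) * a)⁻¹) := by
    have hsq := congrArg Complex.ofReal (norm_sq_div_add_norm_sub_sq_div hs ht φ ψ)
    push_cast at hsq ⊢
    simp only [mul_inv]
    linear_combination (-4⁻¹ * a⁻¹) * hsq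
  simp only [scalarKernel]
  rw [mul_mul_mul_comm, ← Complex.exp_add, hexponents, Complex.exp_add, hprefactors,
    mul_mul_mul_comm]

theorem integrable_scalarKernel_mul_scalarKernel_sub (ha : 0 < a.re) (b : ℂ) (hs : 0 < s)
    (ht : 0 < t) (φ : RSpace d) :
    Integrable fun ψ : RSpace d => scalarKernel a b s ψ * scalarKernel a b t (φ - ψ) := by
  simp only [scalarKernel_mul_scalarKernel_sub a b hs ht]
  exact ((integrable_scalarKernel ha 0 (by positivity)).comp_sub_right _).mul_const _

theorem integral_scalarKernel_mul_scalarKernel_sub (ha : 0 < a.re) (b : ℂ) (hs : 0 < s)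
    (ht : 0 < t) (φ : RSpace d) :
    ∫ ψ : RSpace d, scalarKernel a b s ψ * scalarKernel a b t (φ - ψ)
      = scalarKernel a b (s + t) φ := by
  simp only [scalarKernel_mul_scalarKernel_sub a b hs ht]
  rw [integral_mul_const, integral_sub_right_eq_self (scalarKernel a 0 (s * t / (s + t))),
    integral_scalarKernel ha 0 (by positivity), mul_zero, neg_zero, Complex.exp_zero, one_mul]

/-- The Gaussian `(4πtα)^{-d/2} exp(-βt - c|ψ|²/(4t))`, which dominates `scalarKernel a b t` as soon
as `α ≤ |a|`, `c ≤ Re a / |a|²` and `β ≤ Re b`. -/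
noncomputable def gaussianBound {d : ℕ} (α c β t : ℝ) (ψ : RSpace d) : ℝ :=
  (4 * Real.pi * t * α) ^ (-(d : ℝ) / 2) *
    (Real.exp (-(t * β)) * Real.exp (-(c / (4 * t)) * ‖ψ‖ ^ 2))

variable {α c β : ℝ}

theorem norm_scalarKernel (a b : ℂ) (ht : 0 < t) (ψ : RSpace d) :
    ‖scalarKernel a b t ψ‖ = gaussianBound ‖a‖ (a.re / ‖a‖ ^ 2) b.re t ψ := by
  have hexponent : (-(d : ℂ) / 2) = ((-(d : ℝ) / 2 : ℝ) : ℂ) := by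
    push_cast
    ring
  have hbase : ‖(4 * Real.pi * t * a : ℂ)‖ = 4 * Real.pi * t * ‖a‖ := by
    simp [abs_of_pos, ht, Real.pi_pos]
  rw [scalarKernel, gaussianBound, norm_mul, hexponent, Complex.norm_cpow_real, hbase,
    Complex.norm_exp, ← Real.exp_add, Complex.sub_re, Complex.neg_re, Complex.re_ofReal_mul,
    Complex.re_ofReal_mul, re_four_mul_inv]
  ring_nf

theorem norm_scalarKernel_le (hα : 0 < α) (hαa : α ≤ ‖a‖) (hca : c ≤ a.re / ‖a‖ ^ 2)
    (hβ : β ≤ b.re) (ht : 0 < t) (ψ : RSpace d) :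
    ‖scalarKernel a b t ψ‖ ≤ gaussianBound α c β t ψ := by
  have hexponent : -(d : ℝ) / 2 ≤ 0 := by
    rw [neg_div]
    exact neg_nonpos.2 (by positivity)
  rw [norm_scalarKernel a b ht, gaussianBound, gaussianBound]
  gcongr ?_ * (Real.exp (-(t * ?_)) * Real.exp (-(?_ / _) * _))
  exact Real.rpow_le_rpow_of_nonpos (by positivity) (by gcongr) hexponent

theorem integrable_gaussianBound (α β : ℝ) (hc : 0 < c) (ht : 0 < t) :
    Integrable (gaussianBound (d := d) α c β t) := by
  have hgauss := (integrable_gaussian d (z := (c / (4 * t) : ℝ))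
    (by rw [Complex.ofReal_re]; positivity) 1 0).norm
  refine ((hgauss.congr (Eventually.of_forall fun ψ => ?_)).const_mul _).const_mul _
  simp only [one_mul, Complex.norm_exp, zero_sub, Complex.neg_re, Complex.re_ofReal_mul,
    Complex.ofReal_re, neg_mul, mul_comm]

theorem integral_gaussianBound (hα : 0 < α) (hc : 0 < c) (β : ℝ) (ht : 0 < t) :
    ∫ ψ : RSpace d, gaussianBound α c β t ψ = (α * c)⁻¹ ^ ((d : ℝ) / 2) * Real.exp (-β * t) := by
  unfold gaussianBound
  rw [integral_const_mul, integral_const_mul,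
    GaussianFourier.integral_rexp_neg_mul_sq_norm (by positivity), finrank_euclideanSpace_fin,
    neg_div, Real.rpow_neg (by positivity), mul_left_comm, ← div_eq_inv_mul,
    ← Real.div_rpow (by positivity) (by positivity), mul_comm]
  congr 2
  · field_simp
  · ring

/-- Half of the Gaussian decay is spent on the exponentially small factor, the other half is kept
for integrability. -/
theorem gaussianBound_le_of_le_norm {δ : ℝ} (hα : 0 ≤ α) (hc : 0 ≤ c) (β : ℝ) (hδ : 0 ≤ δ)
    (ht : 0 < t) {ψ : RSpace d} (hψ : δ ≤ ‖ψ‖) :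
    gaussianBound α c β t ψ
      ≤ Real.exp (-(c * δ ^ 2 / 8) * t⁻¹) * gaussianBound α (c / 2) β t ψ := by
  have hdecay : -(c / (4 * t)) * ‖ψ‖ ^ 2
      ≤ -(c * δ ^ 2 / 8) * t⁻¹ + -(c / 2 / (4 * t)) * ‖ψ‖ ^ 2 := by
    have : c * δ ^ 2 / 8 * t⁻¹ ≤ c * ‖ψ‖ ^ 2 / 8 * t⁻¹ := by gcongr
    linear_combination this
  calc gaussianBound α c β t ψ
      ≤ (4 * Real.pi * t * α) ^ (-(d : ℝ) / 2) * (Real.exp (-(t * β)) *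
          Real.exp (-(c * δ ^ 2 / 8) * t⁻¹ + -(c / 2 / (4 * t)) * ‖ψ‖ ^ 2)) := by
        unfold gaussianBound
        gcongr
    _ = Real.exp (-(c * δ ^ 2 / 8) * t⁻¹) * gaussianBound α (c / 2) β t ψ := by
        rw [gaussianBound, Real.exp_add]
        ring

theorem tendsto_setIntegral_compl_ball_gaussianBound {δ : ℝ} (hα : 0 < α) (hc : 0 < c) (β : ℝ)
    (hδ : 0 < δ) :
    Tendsto (fun t => ∫ ψ in (Metric.ball (0 : RSpace d) δ)ᶜ, gaussianBound α c β t ψ) (𝓝[>] 0)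
      (𝓝 0) := by
  have hpos (c t : ℝ) (ht : 0 < t) (ψ : RSpace d) : 0 ≤ gaussianBound α c β t ψ := by
    unfold gaussianBound
    positivity
  have hbound : Tendsto (fun t => Real.exp (-(c * δ ^ 2 / 8) * t⁻¹) *
      ((α * (c / 2))⁻¹ ^ ((d : ℝ) / 2) * Real.exp (-β * t))) (𝓝[>] 0)
      (𝓝 (0 * ((α * (c / 2))⁻¹ ^ ((d : ℝ) / 2) * Real.exp (-β * 0)))) :=
    (Real.tendsto_exp_atBot.comp (tendsto_inv_nhdsGT_zero.const_mul_atTop_of_neg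
      (neg_lt_zero.2 (by positivity)))).mul
      ((Continuous.tendsto (by fun_prop) 0).mono_left nhdsWithin_le_nhds)
  rw [zero_mul] at hbound
  refine squeeze_zero' ?_ ?_ hbound
  · filter_upwards [self_mem_nhdsWithin] with t ht
    exact integral_nonneg (hpos c t ht)
  · filter_upwards [self_mem_nhdsWithin] with t ht
    have hint := (integrable_gaussianBound (d := d) α β (half_pos hc) ht).const_mul
      (Real.exp (-(c * δ ^ 2 / 8) * t⁻¹))
    rw [← integral_gaussianBound hα (half_pos hc) β ht, ← integral_const_mul]
    refine (setIntegral_mono_on (integrable_gaussianBound α β hc ht).integrableOn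
      hint.integrableOn Metric.isOpen_ball.measurableSet.compl fun ψ hψ =>
        gaussianBound_le_of_le_norm hα.le hc.le β hδ.le ht (by simpa using hψ)).trans ?_
    exact setIntegral_le_integral hint (Eventually.of_forall fun ψ =>
      mul_nonneg (Real.exp_nonneg _) (hpos _ t ht ψ))

end ScalarKernel

section SpectralConstants

variable {N : ℕ}

theorem norm_le_specRadius {C : CMat N} {μ : ℂ} (hμ : μ ∈ spectrum ℂ C) : ‖μ‖ ≤ specRadius C :=
  le_csSup (C.finite_spectrum.image _).bddAbove (mem_image_of_mem _ hμ)

theorem neg_specAbscissa_neg_le_re {C : CMat N} {μ : ℂ} (hμ : μ ∈ spectrum ℂ C) :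
    -specAbscissa (-C) ≤ μ.re := by
  have hneg : -μ ∈ spectrum ℂ (-C) := by rwa [← spectrum.neg_eq, Set.neg_mem_neg]
  exact neg_le.1 (le_csSup ((-C).finite_spectrum.image Complex.re).bddAbove
    (mem_image_of_mem Complex.re hneg))

theorem aMin_le_norm {A : CMat N} (hA : IsUnit A) {μ : ℂ} (hμ : μ ∈ spectrum ℂ A) :
    aMin A ≤ ‖μ‖ := by
  obtain ⟨U, rfl⟩ := hA
  have hμ0 : μ ≠ 0 := spectrum.ne_zero_of_mem_of_unit hμ
  have hinv : μ⁻¹ ∈ spectrum ℂ (U : CMat N)⁻¹ := by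
    rw [← Matrix.coe_units_inv]
    exact spectrum.inv₀_mem_inv_iff.2 hμ
  refine inv_le_of_inv_le₀ (norm_pos_iff.2 hμ0) ?_
  rw [← norm_inv]
  exact norm_le_specRadius hinv

variable [Nonempty (Fin N)]

theorem aMin_pos {A : CMat N} (hA : IsUnit A) : 0 < aMin A := by
  obtain ⟨μ, hμ⟩ := spectrum.nonempty_of_isAlgClosed_of_finiteDimensional ℂ A⁻¹
  obtain ⟨U, rfl⟩ := hA
  rw [← Matrix.coe_units_inv] at hμ
  rw [aMin, ← Matrix.coe_units_inv]
  exact inv_pos.2 ((norm_pos_iff.2 (spectrum.ne_zero_of_mem_of_unit hμ)).trans_le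
    (norm_le_specRadius hμ))

theorem aMax_pos {A : CMat N} (hA : ∀ μ ∈ spectrum ℂ A, 0 < μ.re) : 0 < aMax A := by
  obtain ⟨μ, hμ⟩ := spectrum.nonempty_of_isAlgClosed_of_finiteDimensional ℂ A
  exact (hA μ hμ).trans_le ((Complex.re_le_norm μ).trans (norm_le_specRadius hμ))

theorem aZero_pos {A : CMat N} (hA : ∀ μ ∈ spectrum ℂ A, 0 < μ.re) : 0 < aZero A := by
  obtain ⟨μ, hμ, hre⟩ : specAbscissa (-A) ∈ Complex.re '' spectrum ℂ (-A) :=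
    ((spectrum.nonempty_of_isAlgClosed_of_finiteDimensional ℂ (-A)).image _).csSup_mem
      ((-A).finite_spectrum.image _)
  rw [← spectrum.neg_eq, Set.mem_neg] at hμ
  rw [aZero, ← hre, ← Complex.neg_re]
  exact hA _ hμ

end SpectralConstants

section Diagonalization

variable {N : ℕ} {Y : CMat N}

theorem spectrum_conj_diagonal (hY : IsUnit Y) (a : Fin N → ℂ) :
    spectrum ℂ (Y * Matrix.diagonal a * Y⁻¹) = Set.range a := by
  obtain ⟨U, rfl⟩ := hY
  rw [← Matrix.coe_units_inv, spectrum.units_conjugate, spectrum_diagonal]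

theorem conj_diagonal_mul (hY : IsUnit Y) (u v : Fin N → ℂ) :
    (Y * Matrix.diagonal u * Y⁻¹) * (Y * Matrix.diagonal v * Y⁻¹)
      = Y * Matrix.diagonal (fun i => u i * v i) * Y⁻¹ := by
  obtain ⟨U, rfl⟩ := hY
  rw [← Matrix.coe_units_inv, ← Matrix.diagonal_mul_diagonal]
  simp only [mul_assoc, Units.inv_mul_cancel_left]

theorem norm_act_conj_diagonal_le (Y : CMat N) {w : Fin N → ℂ} {C : ℝ} (hC : 0 ≤ C)
    (hw : ∀ i, ‖w i‖ ≤ C) : ‖act (Y * Matrix.diagonal w * Y⁻¹)‖ ≤ condNumber Y * C := by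
  have hdiag : ‖act (Matrix.diagonal w)‖ ≤ C := by
    open scoped Matrix.Norms.L2Operator in
    exact (Matrix.l2_opNorm_toEuclideanCLM _).trans_le
      ((Matrix.l2_opNorm_diagonal w).trans_le ((pi_norm_le_iff_of_nonneg hC).2 hw))
  calc ‖act (Y * Matrix.diagonal w * Y⁻¹)‖
      = ‖act Y * act (Matrix.diagonal w) * act Y⁻¹‖ := by rw [act, map_mul, map_mul]
    _ ≤ ‖act Y‖ * ‖act (Matrix.diagonal w)‖ * ‖act Y⁻¹‖ := norm_mul₃_le
    _ ≤ specNorm Y * C * specNorm Y⁻¹ := by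
        unfold specNorm
        gcongr
    _ = condNumber Y * C := mul_right_comm _ _ _

/-- The projection onto the `i`-th column of `Y` along the other columns: the spectral projections
common to all matrices that `Y` diagonalizes. -/
noncomputable def columnProj (Y : CMat N) (i : Fin N) : CSpace N →L[ℂ] CSpace N :=
  act (Y * Matrix.single i i 1 * Y⁻¹)

theorem act_conj_diagonal (Y : CMat N) (w : Fin N → ℂ) :
    act (Y * Matrix.diagonal w * Y⁻¹) = ∑ i, w i • columnProj Y i := by
  simp only [columnProj, act, ← map_smul, ← map_sum]
  rw [← Matrix.sum_single_eq_diagonal, Finset.mul_sum, Finset.sum_mul]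
  congr 1
  refine Finset.sum_congr rfl fun i _ => ?_
  rw [← smul_mul_assoc, ← mul_smul_comm, Matrix.smul_single, smul_eq_mul, mul_one]

theorem sum_columnProj (hY : IsUnit Y) : ∑ i, columnProj Y i = 1 := by
  have hone := act_conj_diagonal Y fun _ => 1
  rw [Matrix.diagonal_one, mul_one,
    Matrix.mul_nonsing_inv Y ((Matrix.isUnit_iff_isUnit_det Y).1 hY), act, map_one] at hone
  simpa only [one_smul] using hone.symm

end Diagonalization

section MatrixKernel

variable {d N : ℕ} {A B Y : CMat N} {S : RMat d}

theorem Assumptions.isUnit_A (h : Assumptions A B Y S) : IsUnit A := by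
  by_contra hA
  simpa using h.spec_A 0 (spectrum.zero_mem ℂ hA)

theorem Assumptions.exists_kernelK_eq (h : Assumptions A B Y S) :
    ∃ a b : Fin N → ℂ, (∀ i, a i ∈ spectrum ℂ A) ∧ (∀ i, b i ∈ spectrum ℂ B) ∧
      ∀ ⦃t : ℝ⦄, 0 < t → ∀ ψ : RSpace d, kernelK A B ψ t =
        Y * Matrix.diagonal (fun i => scalarKernel (a i) (b i) t ψ) * Y⁻¹ := by
  obtain ⟨a, b, hA, hB, ha⟩ := h.exists_diag
  refine ⟨a, b, fun i => ?_, fun i => ?_, fun t ht ψ =>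
    kernelK_eq h.isUnit_Y hA hB (fun i => Complex.ne_zero_of_re_pos (ha i)) ht ψ⟩
  · exact hA ▸ spectrum_conj_diagonal h.isUnit_Y a ▸ mem_range_self i
  · exact hB ▸ spectrum_conj_diagonal h.isUnit_Y b ▸ mem_range_self i

theorem Assumptions.exists_act_kernelK_eq_sum (h : Assumptions A B Y S) :
    ∃ a b : Fin N → ℂ, (∀ i, 0 < (a i).re) ∧
      ∀ ⦃t : ℝ⦄, 0 < t → ∀ ψ : RSpace d, act (kernelK A B ψ t) =
        ∑ i, scalarKernel (a i) (b i) t ψ • columnProj Y i := by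
  obtain ⟨a, b, ha, -, hK⟩ := h.exists_kernelK_eq
  exact ⟨a, b, fun i => h.spec_A _ (ha i), fun t ht ψ => by rw [hK ht, act_conj_diagonal]⟩

theorem norm_act_kernelK_le [Nonempty (Fin N)] (h : Assumptions A B Y S) {t : ℝ} (ht : 0 < t)
    (ψ : RSpace d) :
    ‖act (kernelK A B ψ t)‖
      ≤ condNumber Y * gaussianBound (aMin A) (aZero A / aMax A ^ 2) (bZero B) t ψ := by
  obtain ⟨a, b, ha, hb, hK⟩ := h.exists_kernelK_eq
  have hentry (i : Fin N) : ‖scalarKernel (a i) (b i) t ψ‖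
      ≤ gaussianBound (aMin A) (aZero A / aMax A ^ 2) (bZero B) t ψ := by
    have hre : 0 < (a i).re := h.spec_A _ (ha i)
    have hnorm : 0 < ‖a i‖ := hre.trans_le (Complex.re_le_norm _)
    refine norm_scalarKernel_le (aMin_pos h.isUnit_A) (aMin_le_norm h.isUnit_A (ha i)) ?_
      (neg_specAbscissa_neg_le_re (hb i)) ht ψ
    exact div_le_div₀ hre.le (neg_specAbscissa_neg_le_re (ha i)) (by positivity)
      (pow_le_pow_left₀ hnorm.le (norm_le_specRadius (ha i)) 2)
  rw [hK ht]
  exact norm_act_conj_diagonal_le Y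
    ((norm_nonneg _).trans (hentry (Classical.arbitrary (Fin N)))) hentry

theorem integral_norm_act_kernelK_le (h : Assumptions A B Y S) {t : ℝ} (ht : 0 < t) :
    ∫ ψ : RSpace d, ‖act (kernelK A B ψ t)‖ ≤ Mb d A Y * Real.exp (omegaB B * t) := by
  rcases isEmpty_or_nonempty (Fin N) with _ | _
  · have hzero (C : CSpace N →L[ℂ] CSpace N) : ‖C‖ = 0 := by
      rw [Subsingleton.elim C 0, norm_zero]
    simp [Mb, condNumber, specNorm, hzero]
  have hmin := aMin_pos h.isUnit_A
  have hc : 0 < aZero A / aMax A ^ 2 :=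
    div_pos (aZero_pos h.spec_A) (pow_pos (aMax_pos h.spec_A) 2)
  have hone : aOne A = (aMin A * (aZero A / aMax A ^ 2))⁻¹ := by
    rw [aOne, ← mul_div_assoc, inv_div]
  calc ∫ ψ : RSpace d, ‖act (kernelK A B ψ t)‖
      ≤ ∫ ψ : RSpace d,
          condNumber Y * gaussianBound (aMin A) (aZero A / aMax A ^ 2) (bZero B) t ψ :=
        integral_mono (integrable_kernelK h ht).norm
          ((integrable_gaussianBound _ _ hc ht).const_mul _) (norm_act_kernelK_le h ht)
    _ = Mb d A Y * Real.exp (omegaB B * t) := by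
        rw [integral_const_mul, integral_gaussianBound hmin hc _ ht, Mb, hone, omegaB, mul_assoc]

theorem integral_act_kernelK_mul (h : Assumptions A B Y S) {s t : ℝ} (hs : 0 < s) (ht : 0 < t)
    (φ : RSpace d) :
    ∫ ψ, act (kernelK A B ψ s) * act (kernelK A B (φ - ψ) t) = act (kernelK A B φ (s + t)) := by
  obtain ⟨a, b, ha, -, hK⟩ := h.exists_kernelK_eq
  have hre (i : Fin N) : 0 < (a i).re := h.spec_A _ (ha i)
  have hmul (ψ : RSpace d) : act (kernelK A B ψ s) * act (kernelK A B (φ - ψ) t) = ∑ i,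
      (scalarKernel (a i) (b i) s ψ * scalarKernel (a i) (b i) t (φ - ψ)) • columnProj Y i := by
    rw [hK hs, hK ht, act, act, ← map_mul, conj_diagonal_mul h.isUnit_Y]
    exact act_conj_diagonal Y _
  simp only [hmul]
  rw [integral_finsetSum _ fun i _ =>
    (integrable_scalarKernel_mul_scalarKernel_sub (hre i) (b i) hs ht φ).smul_const _]
  simp only [integral_smul_const,
    integral_scalarKernel_mul_scalarKernel_sub (hre _) (b _) hs ht, hK (add_pos hs ht),
    act_conj_diagonal]

theorem tendsto_integral_act_kernelK (h : Assumptions A B Y S) :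
    Tendsto (fun t : ℝ => ∫ ψ : RSpace d, act (kernelK A B ψ t)) (𝓝[>] 0) (𝓝 1) := by
  obtain ⟨a, b, ha, hK⟩ := h.exists_act_kernelK_eq_sum
  have hcont : Tendsto (fun t : ℝ => ∑ i, Complex.exp (-(t * b i)) • columnProj Y i) (𝓝[>] 0)
      (𝓝 (∑ i, Complex.exp (-((0 : ℝ) * b i)) • columnProj Y i)) :=
    (Continuous.tendsto (by fun_prop) 0).mono_left nhdsWithin_le_nhds
  simp only [Complex.ofReal_zero, zero_mul, neg_zero, Complex.exp_zero, one_smul,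
    sum_columnProj h.isUnit_Y] at hcont
  refine hcont.congr' ?_
  filter_upwards [self_mem_nhdsWithin] with t ht
  simp only [hK (mem_Ioi.1 ht)]
  rw [integral_finsetSum _ fun i _ =>
    (integrable_scalarKernel (ha i) (b i) (mem_Ioi.1 ht)).smul_const _]
  simp only [integral_smul_const, integral_scalarKernel (ha _) (b _) (mem_Ioi.1 ht)]

theorem tendsto_setIntegral_compl_ball_norm_act_kernelK (h : Assumptions A B Y S) {δ : ℝ}
    (hδ : 0 < δ) :
    Tendsto (fun t : ℝ => ∫ ψ in (Metric.ball (0 : RSpace d) δ)ᶜ, ‖act (kernelK A B ψ t)‖)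
      (𝓝[>] 0) (𝓝 0) := by
  obtain ⟨a, b, ha, hK⟩ := h.exists_act_kernelK_eq_sum
  have hnorm (i : Fin N) : 0 < ‖a i‖ := (ha i).trans_le (Complex.re_le_norm _)
  have hc (i : Fin N) : 0 < (a i).re / ‖a i‖ ^ 2 := div_pos (ha i) (pow_pos (hnorm i) 2)
  have hbound : Tendsto (fun t => ∑ i, (∫ ψ in (Metric.ball (0 : RSpace d) δ)ᶜ,
      gaussianBound ‖a i‖ ((a i).re / ‖a i‖ ^ 2) (b i).re t ψ) * ‖columnProj Y i‖) (𝓝[>] 0)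
      (𝓝 (∑ i, 0 * ‖columnProj Y i‖)) :=
    tendsto_finsetSum _ fun i _ =>
      (tendsto_setIntegral_compl_ball_gaussianBound (hnorm i) (hc i) _ hδ).mul_const _
  simp only [zero_mul, Finset.sum_const_zero] at hbound
  refine squeeze_zero' (Eventually.of_forall fun t => integral_nonneg fun ψ => norm_nonneg _) ?_
    hbound
  filter_upwards [self_mem_nhdsWithin] with t ht
  have hint (i : Fin N) : IntegrableOn (fun ψ : RSpace d =>
      gaussianBound ‖a i‖ ((a i).re / ‖a i‖ ^ 2) (b i).re t ψ * ‖columnProj Y i‖)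
      (Metric.ball 0 δ)ᶜ :=
    ((integrable_gaussianBound _ _ (hc i) ht).mul_const _).integrableOn
  simp only [← integral_mul_const]
  rw [← integral_finsetSum _ fun i _ => hint i]
  refine integral_mono (integrable_kernelK h ht).norm.integrableOn
    (integrable_finsetSum _ fun i _ => hint i) fun ψ => ?_
  rw [hK ht]
  refine (norm_sum_le _ _).trans_eq (Finset.sum_congr rfl fun i _ => ?_)
  rw [norm_smul, norm_scalarKernel _ _ (mem_Ioi.1 ht)]

end MatrixKernel

section ApproximateIdentity

variable {V : Type*} [NormedAddCommGroup V] [NormedSpace ℂ V]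

theorem norm_integral_apply_sub_le {α : Type*} [MeasurableSpace α]
    {μ : Measure α} {K : α → V →L[ℂ] V} (hK : Integrable K μ) {f : α → V}
    (hf : AEStronglyMeasurable f μ) {w : V} {C η : ℝ} {s : Set α} (hs : MeasurableSet s)
    (hfC : ∀ x, ‖f x‖ ≤ C) (hwC : ‖w‖ ≤ C) (hη : 0 ≤ η) (hfw : ∀ x ∈ s, ‖f x - w‖ ≤ η) :
    ‖∫ x, K x (f x) ∂μ - w‖ ≤
      (∫ x, ‖K x‖ ∂μ) * η + (∫ x in sᶜ, ‖K x‖ ∂μ) * (C + C) + ‖∫ x, K x ∂μ - 1‖ * C := by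
  have hKf : Integrable (fun x => K x (f x)) μ :=
    (ContinuousLinearMap.id ℂ (V →L[ℂ] V)).integrable_of_bilin_of_bdd_right C hK hf
      (Eventually.of_forall hfC)
  have hsplit : ∫ x, K x (f x) ∂μ - w = ∫ x, K x (f x - w) ∂μ + (∫ x, K x ∂μ - 1) w := by
    simp only [map_sub]
    rw [integral_sub hKf (hK.apply_continuousLinearMap w), sub_apply,
      ContinuousLinearMap.integral_apply hK, one_apply_eq_self, sub_add_sub_cancel]
  have hbound (x : α) :
      ‖K x (f x - w)‖ ≤ ‖K x‖ * η + sᶜ.indicator (fun x => ‖K x‖) x * (C + C) := by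
    refine ((K x).le_opNorm _).trans ?_
    by_cases hx : x ∈ s
    · simpa [hx] using mul_le_mul_of_nonneg_left (hfw x hx) (norm_nonneg (K x))
    · rw [indicator_of_mem (mem_compl hx), ← mul_add]
      gcongr
      exact ((norm_sub_le _ _).trans (add_le_add (hfC x) hwC)).trans (le_add_of_nonneg_left hη)
  have hmain : ‖∫ x, K x (f x - w) ∂μ‖ ≤
      (∫ x, ‖K x‖ ∂μ) * η + (∫ x in sᶜ, ‖K x‖ ∂μ) * (C + C) := by
    have hi := hK.norm.mul_const η
    have ht := (hK.norm.indicator hs.compl).mul_const (C + C)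
    rw [← integral_indicator hs.compl, ← integral_mul_const, ← integral_mul_const,
      ← integral_add hi ht]
    exact norm_integral_le_of_norm_le (hi.add ht) (Eventually.of_forall hbound)
  rw [hsplit]
  exact (norm_add_le _ _).trans (add_le_add hmain (ContinuousLinearMap.le_opNorm_of_le _ hwC))

theorem tendstoUniformly_integral_apply_sub {G : Type*} [NormedAddCommGroup G]
    [MeasurableSpace G] [OpensMeasurableSpace G] [SecondCountableTopology G] {μ : Measure G}
    {ι : Type*} {l : Filter ι} {K : ι → G → V →L[ℂ] V} (hK : ∀ᶠ i in l, Integrable (K i) μ)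
    (hbdd : l.IsBoundedUnder (· ≤ ·) fun i => ∫ ψ, ‖K i ψ‖ ∂μ)
    (hone : Tendsto (fun i => ∫ ψ, K i ψ ∂μ) l (𝓝 1))
    (htail : ∀ δ > 0, Tendsto (fun i => ∫ ψ in (Metric.ball 0 δ)ᶜ, ‖K i ψ‖ ∂μ) l (𝓝 0))
    {v : G →ᵇ V} (hv : UniformContinuous v) :
    TendstoUniformly (fun i y => ∫ ψ, K i ψ (v (y - ψ)) ∂μ) v l := by
  rw [Metric.tendstoUniformly_iff]
  intro ε hε
  obtain ⟨C, hC⟩ := hbdd.eventually_le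
  obtain ⟨η, hη, hCη⟩ := exists_pos_mul_lt hε C
  obtain ⟨δ, hδ, hvδ⟩ := Metric.uniformContinuous_iff.1 hv η hη
  have herror : Tendsto (fun i => C * η + (∫ ψ in (Metric.ball 0 δ)ᶜ, ‖K i ψ‖ ∂μ) * (‖v‖ + ‖v‖) +
      ‖∫ ψ, K i ψ ∂μ - 1‖ * ‖v‖) l (𝓝 (C * η)) := by
    simpa using (((htail δ hδ).mul_const (‖v‖ + ‖v‖)).const_add (C * η)).add
      ((hone.sub_const 1).norm.mul_const ‖v‖)
  filter_upwards [hK, hC, herror.eventually_lt_const hCη] with i hKi hCi hlt y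
  rw [dist_comm, dist_eq_norm]
  refine (norm_integral_apply_sub_le hKi
    (v.continuous.comp (continuous_sub_left y)).aestronglyMeasurable
    Metric.isOpen_ball.measurableSet (fun ψ => v.norm_coe_le_norm _) (v.norm_coe_le_norm y) hη.le
    fun ψ hψ => ?_).trans_lt (lt_of_le_of_lt (by gcongr) hlt)
  rw [← dist_eq_norm]
  refine (hvδ ?_).le
  rwa [dist_eq_norm, sub_sub_cancel_left, norm_neg, ← mem_ball_zero_iff]

end ApproximateIdentity

section SemigroupLaw

open scoped Convolution

variable {d N : ℕ} {A B Y : CMat N} {S : RMat d}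

theorem integral_act_kernelK_comp_rot (hS : S.transpose = -S) (s t : ℝ)
    (f : RSpace d → CSpace N) :
    ∫ ψ, act (kernelK A B ψ t) (f (rot S s ψ)) = ∫ ψ, act (kernelK A B ψ t) (f ψ) := by
  rw [← (rotEquiv hS s).measurePreserving.integral_comp
    (rotEquiv hS s).toHomeomorph.measurableEmbedding fun ψ => act (kernelK A B ψ t) (f ψ)]
  refine integral_congr_ae (Eventually.of_forall fun ψ => ?_)
  change act (kernelK A B ψ t) (f (rot S s ψ)) = act (kernelK A B (rot S s ψ) t) (f (rot S s ψ))
  rw [kernelK_rot hS]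

theorem semigroupFun_eq_convolution {t : ℝ} (ht : 0 < t) (v : RSpace d → CSpace N)
    (x : RSpace d) : semigroupFun A B S t v x =
      ((fun ψ => act (kernelK A B ψ t)) ⋆[.id ℂ (CSpace N →L[ℂ] CSpace N)] v) (rot S t x) :=
  semigroupFun_eq ht v x

theorem convolution_act_kernelK_convolution (h : Assumptions A B Y S) {s t : ℝ} (hs : 0 < s)
    (ht : 0 < t) (v : RSpace d →ᵇ CSpace N) (y : RSpace d) :
    ((fun ψ => act (kernelK A B ψ s)) ⋆[.id ℂ (CSpace N →L[ℂ] CSpace N)]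
      ((fun ψ => act (kernelK A B ψ t)) ⋆[.id ℂ (CSpace N →L[ℂ] CSpace N)] v)) y =
      ((fun ψ => act (kernelK A B ψ (s + t))) ⋆[.id ℂ (CSpace N →L[ℂ] CSpace N)] v) y := by
  let mul := ContinuousLinearMap.mul ℂ (CSpace N →L[ℂ] CSpace N)
  let apply := ContinuousLinearMap.id ℂ (CSpace N →L[ℂ] CSpace N)
  have hKs := integrable_kernelK (d := d) h hs
  have hKt := integrable_kernelK (d := d) h ht
  have hint := apply.integrable_of_bilin_of_bdd_right ‖v‖ (hKs.convolution_integrand mul hKt)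
    (g := fun p : RSpace d × RSpace d => v (y - p.1))
    (v.continuous.comp (by fun_prop)).aestronglyMeasurable
    (Eventually.of_forall fun p => v.norm_coe_le_norm _)
  have hassoc := convolution_assoc' (x₀ := y) (k := v) mul apply apply apply (fun _ _ _ => rfl)
    (hKs.ae_convolution_exists mul hKt)
    (Eventually.of_forall fun x => integrable_act_apply hKt v (fun ψ => x - ψ) (by fun_prop)) hint
  have hconv : (fun ψ => act (kernelK A B ψ s)) ⋆[mul] (fun ψ => act (kernelK A B ψ t)) =
      fun φ : RSpace d => act (kernelK A B φ (s + t)) :=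
    funext (integral_act_kernelK_mul h hs ht)
  rw [← hassoc, hconv]

theorem semigroupFun_semigroupFun (h : Assumptions A B Y S) {s t : ℝ} (hs : 0 < s) (ht : 0 < t)
    (v : RSpace d →ᵇ CSpace N) (x : RSpace d) :
    semigroupFun A B S s (semigroupFun A B S t v) x = semigroupFun A B S (s + t) v x := by
  rw [semigroupFun_eq_convolution (add_pos hs ht), ← convolution_act_kernelK_convolution h hs ht,
    semigroupFun_eq hs, ← integral_act_kernelK_comp_rot h.skew_S (-t)]
  refine integral_congr_ae (Eventually.of_forall fun ψ => ?_)
  simp only [semigroupFun_eq_convolution ht, map_sub, rot_rot, add_neg_cancel, rot_zero,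
    add_comm t s]
  rfl

theorem tendsto_semigroup (h : Assumptions A B Y S) (v : Crub S (CSpace N)) :
    Tendsto (fun t => semigroup h t v) (𝓝[>] 0) (𝓝 v) := by
  have hbdd : (𝓝[>] (0 : ℝ)).IsBoundedUnder (· ≤ ·)
      fun t => ∫ ψ : RSpace d, ‖act (kernelK A B ψ t)‖ := by
    have hcont : Continuous fun t => Mb d A Y * Real.exp (omegaB B * t) := by fun_prop
    exact ((hcont.tendsto 0).mono_left nhdsWithin_le_nhds).isBoundedUnder_le.mono_le
      (eventually_mem_nhdsWithin.mono fun t ht => integral_norm_act_kernelK_le h ht)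
  have hkernel := tendstoUniformly_integral_apply_sub
    (eventually_mem_nhdsWithin.mono fun t ht => integrable_kernelK h ht) hbdd
    (tendsto_integral_act_kernelK h)
    (fun δ hδ => tendsto_setIntegral_compl_ball_norm_act_kernelK h hδ) v.2.1
  have hneg : Tendsto (fun t : ℝ => -t) (𝓝[>] 0) (𝓝 0) :=
    (continuous_neg.tendsto' 0 0 neg_zero).mono_left nhdsWithin_le_nhds
  rw [tendsto_subtype_rng, BoundedContinuousFunction.tendsto_iff_tendstoUniformly,
    Metric.tendstoUniformly_iff]
  intro ε hε
  filter_upwards [hneg.eventually (Metric.tendstoUniformly_iff.1 v.2.2 _ (half_pos hε)),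
    Metric.tendstoUniformly_iff.1 hkernel _ (half_pos hε), self_mem_nhdsWithin]
    with t hrot hker ht x
  rw [semigroup_apply, semigroupFun_eq ht]
  refine (dist_triangle _ (v.1 (rot S t x)) _).trans_lt ?_
  rw [← add_halves ε]
  exact add_lt_add (by simpa only [neg_neg] using hrot x) (hker (rot S t x))

theorem semigroup_zero (h : Assumptions A B Y S) : semigroup h 0 = 1 :=
  dif_neg (lt_irrefl 0)

theorem semigroup_add (h : Assumptions A B Y S) {s t : ℝ} (hs : 0 ≤ s) (ht : 0 ≤ t) :
    semigroup h (s + t) = semigroup h s * semigroup h t := by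
  rcases hs.eq_or_lt with rfl | hs
  · rw [zero_add, semigroup_zero, one_mul]
  rcases ht.eq_or_lt with rfl | ht
  · rw [add_zero, semigroup_zero, mul_one]
  ext1 v; ext1; ext1 x
  simp only [mul_apply_eq_comp, semigroup_apply, ← semigroupFun_semigroupFun h hs ht]
  exact congrArg (semigroupFun A B S s · x) (funext fun y => (semigroup_apply h t v y).symm)

theorem norm_semigroup_le (h : Assumptions A B Y S) {t : ℝ} (ht : 0 < t) :
    ‖semigroup h t‖ ≤ Mb d A Y * Real.exp (omegaB B * t) := by
  refine le_trans ?_ (integral_norm_act_kernelK_le h ht)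
  rw [semigroup, dif_pos ht]
  exact LinearMap.mkContinuous_norm_le _ (integral_nonneg fun _ => norm_nonneg _) _

theorem isC0Semigroup_semigroup (h : Assumptions A B Y S) :
    IsC0Semigroup (semigroup h) (Mb d A Y) (omegaB B) where
  map_zero := semigroup_zero h
  map_add := semigroup_add h
  opNorm_le := norm_semigroup_le h
  tendsto_zero := tendsto_semigroup h

end SemigroupLaw

section PointwiseIntegral

variable {d : ℕ} {S : RMat d} {F : Type*} [NormedAddCommGroup F] [NormedSpace ℂ F]
  {α : Type*} [MeasurableSpace α] {μ : Measure α} {f : α → Crub S F}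

theorem Crub.integrable_apply (hf : Integrable f μ) (x : RSpace d) :
    Integrable (fun a => (f a).1 x) μ :=
  ((BoundedContinuousFunction.evalCLM ℂ x).comp (Crub S F).subtypeL).integrable_comp hf

theorem Crub.integral_apply [CompleteSpace F] (hf : Integrable f μ) (x : RSpace d) :
    (∫ a, f a ∂μ).1 x = ∫ a, (f a).1 x ∂μ :=
  (((BoundedContinuousFunction.evalCLM ℂ x).comp (Crub S F).subtypeL).integral_comp_comm hf).symm

end PointwiseIntegral

theorem eqOn_exp_smul_semigroup_apply {d N : ℕ} {A B Y : CMat N} {S : RMat d}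
    (h : Assumptions A B Y S) (lam : ℂ) (g : Crub S (CSpace N)) (x : RSpace d) :
    EqOn (fun t : ℝ => (Complex.exp (-lam * t) • semigroup h t g).1 x)
      (fun t : ℝ => Complex.exp (-lam * t) • ∫ ξ, act (heatKernel A B S x ξ t) (g.1 ξ))
      (Ioi 0) := by
  intro t ht
  change Complex.exp (-lam * t) • (semigroup h t g).1 x = _
  rw [semigroup_apply, semigroupFun, if_pos (mem_Ioi.1 ht)]

end OrnsteinUhlenbeck

theorem corollary6p4 {d N : ℕ} {A B Y : OrnsteinUhlenbeck.CMat N} {S : OrnsteinUhlenbeck.RMat d}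
    (h : OrnsteinUhlenbeck.Assumptions A B Y S)
    (lam : ℂ) (hlam : OrnsteinUhlenbeck.omegaB B < lam.re)
    (g : OrnsteinUhlenbeck.Crub S (OrnsteinUhlenbeck.CSpace N)) :
    ∃ v : (OrnsteinUhlenbeck.Ab h).domain,
      -- `v` is the unique solution of the resolvent equation in the domain of the generator
      (lam • (v : OrnsteinUhlenbeck.Crub S (OrnsteinUhlenbeck.CSpace N)) - OrnsteinUhlenbeck.Ab h v = g ∧
        ∀ w : (OrnsteinUhlenbeck.Ab h).domain,
          lam • (w : OrnsteinUhlenbeck.Crub S (OrnsteinUhlenbeck.CSpace N)) - OrnsteinUhlenbeck.Ab h w = g → w = v) ∧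
      -- the Laplace transform formula, as an absolutely convergent integral in `C_rub`
      (IntegrableOn (fun t : ℝ => Complex.exp (-lam * t) • OrnsteinUhlenbeck.semigroup h t g)
          (Ioi 0) ∧
        (v : OrnsteinUhlenbeck.Crub S (OrnsteinUhlenbeck.CSpace N)) =
          ∫ t in Ioi (0 : ℝ), Complex.exp (-lam * t) • OrnsteinUhlenbeck.semigroup h t g) ∧
      -- the same formula, pointwise and with the heat kernel written out
      (∀ x : OrnsteinUhlenbeck.RSpace d,
        (∀ t : ℝ, 0 < t → Integrable (fun ξ : OrnsteinUhlenbeck.RSpace d =>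
          OrnsteinUhlenbeck.act (OrnsteinUhlenbeck.heatKernel A B S x ξ t) (g.1 ξ))) ∧
        IntegrableOn (fun t : ℝ => Complex.exp (-lam * t) •
          ∫ ξ : OrnsteinUhlenbeck.RSpace d,
            OrnsteinUhlenbeck.act (OrnsteinUhlenbeck.heatKernel A B S x ξ t) (g.1 ξ)) (Ioi 0) ∧
        (v : OrnsteinUhlenbeck.Crub S (OrnsteinUhlenbeck.CSpace N)).1 x =
          ∫ t in Ioi (0 : ℝ), Complex.exp (-lam * t) •
            ∫ ξ : OrnsteinUhlenbeck.RSpace d,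
              OrnsteinUhlenbeck.act (OrnsteinUhlenbeck.heatKernel A B S x ξ t) (g.1 ξ)) ∧
      -- the resolvent estimate, in the supremum norm
      ‖(v : OrnsteinUhlenbeck.Crub S (OrnsteinUhlenbeck.CSpace N)).1‖ ≤
        OrnsteinUhlenbeck.Mb d A Y / (lam.re - OrnsteinUhlenbeck.omegaB B) * ‖g.1‖ := by
  have hT := OrnsteinUhlenbeck.isC0Semigroup_semigroup h
  have hint := hT.integrableOn_exp_smul hlam g
  have heq := OrnsteinUhlenbeck.eqOn_exp_smul_semigroup_apply h lam g
  refine ⟨⟨hT.laplace hlam g, hT.laplace_mem_domain_generator hlam g⟩,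
    ⟨hT.smul_laplace_sub_generator hlam g, fun w hw => Subtype.ext ?_⟩,
    ⟨hint, hT.laplace_apply hlam g⟩,
    fun x => ⟨fun t ht => OrnsteinUhlenbeck.integrable_heatKernel h ht g.1 x, ?_, ?_⟩,
    hT.norm_integral_exp_smul_le hlam g⟩
  · rw [← hw]
    exact (hT.laplace_smul_sub_generator hlam w).symm
  · exact IntegrableOn.congr_fun (OrnsteinUhlenbeck.Crub.integrable_apply hint x) (heq x)
      measurableSet_Ioi
  · exact (OrnsteinUhlenbeck.Crub.integral_apply hint x).trans
      (setIntegral_congr_fun measurableSet_Ioi (heq x))
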